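/- **Conventions.** A *skew lattice* (with zero) is a set $S$ with two associative, idempotent binary operations $\wedge,\vee$ and an element $0$ satisfying $x\wedge(x\vee y)=x=x\vee(x\wedge y)$, $(y\vee x)\wedge x=x=(y\wedge x)\vee x$ and $x\wedge 0=0=0\wedge x$. It is *strongly distributive* if $x\wedge(y\vee z)=(x\wedge y)\vee(x\wedge z)$ and $(y\vee z)\wedge x=(y\wedge x)\vee(z\wedge x)$, and *left-handed* if $x\wedge y\wedge x=x\wedge y$. The relation $x\mathrel{\mathcal D}y\iff x\wedge y\wedge x=x$ and $y\wedge x\wedge y=y$ is a congruence, and $S/\mathcal D$ is a lattice. A homomorphism $h:S\to T$ (preserving $\wedge,\vee,0$) is *proper* if for every $y\in T/\mathcal D$ there is $x\in S/\mathcal D$ with $y\le\overline h(x)$, where $\overline h:S/\mathcal D\to T/\mathcal D$ is the induced map. $\mathsf{DSL}$ is the category of left-handed strongly distributive skew lattices with zero and proper homomorphisms. A *Priestley space* is a compact topological space with a partial order such that, whenever $x\not\le y$, there is a clopen upset containing $x$ and not $y$. A *local Priestley space* is a partially ordered topological space $X$ whose one-point-compactification $\hat X=X\cup\{\ast\}$,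 ordered with $\ast$ as an added maximum, is a Priestley space. A morphism $f:X\to Y$ of local Priestley spaces is the restriction of a continuous monotone map $\hat X\to\hat Y$ for which the inverse image of $\ast_Y$ is $\{\ast_X\}$. $\mathsf{Sh}(\mathsf{LPS})$ is the following category. An object $(X,E)$ is a local Priestley space $X$ with a sheaf of sets $E$ on $X$ all of whose stalks are nonempty (equivalently, whose étale map is surjective). A morphism $(X,E)\to(Y,F)$ is a pair $(f,\lambda)$ of a morphism $f:X\to Y$ of local Priestley spaces and a natural transformation $\lambda:F\Rightarrow f_*E$, where $(f_*E)(V)=E(f^{-1}(V))$. The composite of $(f,\lambda):(X,E)\to(Y,F)$ and $(g,\mu):(Y,F)\to(Z,G)$ is $(gf,\sigma)$ with $\sigma_U=\lambda_{g^{-1}(U)}\circ\mu_U$. For such $(X,E)$ let $E^\star=\bigsqcup_U E(U)$, where $U$ ranges over the compact open downsets of $X$. For $a\in E(U)$ and $b\in E(V)$ let $a\wedge b=a|_{U\cap V}$ (restriction), let $a\vee b\in E(U\cup V)$ be the unique section that restricts to $b$ on $V$ and to $a|_{U\setminus V}$ on $U\setminus V$ (override), and let $0$ be the unique element of $E(\emptyset)$.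 For $(f,\lambda):(X,E)\to(Y,F)$ and $a\in F(U)$ with $U$ a compact open downset of $Y$, let $(f,\lambda)^\star(a)=\lambda_U(a)\in E(f^{-1}(U))$. **Theorem.** These assignments define a contravariant functor $(-)^\star:\mathsf{Sh}(\mathsf{LPS})\to\mathsf{DSL}$, and this functor is one half of a dual equivalence between the categories $\mathsf{Sh}(\mathsf{LPS})$ and $\mathsf{DSL}$. In particular $\mathsf{DSL}$ is dually equivalent to $\mathsf{Sh}(\mathsf{LPS})$. -/

import Mathlib

open CategoryTheory TopologicalSpace Opposite
open scoped OnePoint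

universe u v w

/-- A skew lattice with zero: `⊓` and `⊔` are associative and idempotent and satisfy the four
absorption identities, and `0` is absorbing for `⊓`. -/
class SkewLattice (S : Type u) extends Min S, Max S, Zero S where
  inf_assoc (x y z : S) : (x ⊓ y) ⊓ z = x ⊓ (y ⊓ z)
  sup_assoc (x y z : S) : (x ⊔ y) ⊔ z = x ⊔ (y ⊔ z)
  inf_idem (x : S) : x ⊓ x = x
  sup_idem (x : S) : x ⊔ x = x
  inf_sup_absorb (x y : S) : x ⊓ (x ⊔ y) = x
  sup_inf_absorb (x y : S) : x ⊔ (x ⊓ y) = x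
  sup_inf_absorb' (x y : S) : (y ⊔ x) ⊓ x = x
  inf_sup_absorb' (x y : S) : (y ⊓ x) ⊔ x = x
  inf_zero (x : S) : x ⊓ 0 = 0
  zero_inf (x : S) : 0 ⊓ x = 0

/-- Strong distributivity: `⊓` distributes over `⊔` on both sides. -/
class SkewLattice.IsStronglyDistributive (S : Type u) [SkewLattice S] : Prop where
  inf_sup (x y z : S) : x ⊓ (y ⊔ z) = (x ⊓ y) ⊔ (x ⊓ z)
  sup_inf (x y z : S) : (y ⊔ z) ⊓ x = (y ⊓ x) ⊔ (z ⊓ x)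

/-- Left-handedness. -/
class SkewLattice.IsLeftHanded (S : Type u) [SkewLattice S] : Prop where
  inf_inf (x y : S) : x ⊓ y ⊓ x = x ⊓ y

namespace SkewLattice

section Band

variable {B : Type u} [Semigroup B]

theorem band_below (hi : ∀ x : B, x * x = x) {w p y q : B} (h : w = p * y * q) :
    w * y * w = w := by
  have key : ∀ u b : B, w = u * b → w * u * w = w := by
    intro u b e
    have : w * u * w = u * b * (u * u) * b := by rw [e]; simp only [mul_assoc]
    rw [this, hi, mul_assoc, mul_assoc, ← mul_assoc, hi, e]
  have h2 : w = (w * p) * (y * w) := by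
    have := key (p * y) q h
    simp only [mul_assoc] at this ⊢
    exact this.symm
  generalize hz : y * w = z at h2
  generalize w * p = t at h2
  have h3 : w * z * w = w := by
    have : w * z * w = t * (z * z) * (t * z) := by rw [h2]; simp only [mul_assoc]
    rw [this, hi, hi, h2]
  rw [← hz] at h3
  have : w * (y * w) * w = w * y * (w * w) := by simp only [mul_assoc]
  rw [this, hi] at h3
  exact h3

theorem band_trans (hi : ∀ x : B, x * x = x) {x y z : B} (h : x * y * x = x) (h' : y * z * y = y) :
    x * z * x = x := by
  refine band_below hi (p := x * y) (q := y * x) ?_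
  calc x = x * (y * z * y) * x := by rw [h', h]
    _ = _ := by simp only [mul_assoc]

theorem band_meet (hi : ∀ x : B, x * x = x) {w x y : B} (h : w * x * w = w) (h' : w * y * w = w) :
    w * (x * y) * w = w := by
  refine band_below hi (p := w * (x * w) * y) (q := x * (w * y) * w) ?_
  calc w = w * x * w * y * w := by rw [h, h']
    _ = w * (x * w * y) * w := by simp only [mul_assoc]
    _ = w * ((x * w * y) * (x * w * y)) * w := by rw [hi]
    _ = w * (x * w) * (y * x) * (w * y) * w := by simp only [mul_assoc]
    _ = w * (x * w) * ((y * x) * (y * x)) * (w * y) * w := by rw [hi]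
    _ = _ := by simp only [mul_assoc]

theorem band_left (hi : ∀ x : B, x * x = x) (x y : B) : (x * y) * x * (x * y) = x * y := by
  have : (x * y) * x * (x * y) = x * y * (x * x) * y := by simp only [mul_assoc]
  rw [this, hi, mul_assoc, hi]

theorem band_right (hi : ∀ x : B, x * x = x) (x y : B) : (x * y) * y * (x * y) = x * y := by
  have : (x * y) * y * (x * y) = x * (y * y) * (x * y) := by simp only [mul_assoc]
  rw [this, hi, hi]

end Band

variable {S : Type u} [SkewLattice S]

/-- The semigroup `(S, ⊓)`. -/
abbrev infSemigroup (S : Type u) [SkewLattice S] : Semigroup S where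
  mul x y := x ⊓ y
  mul_assoc := inf_assoc

/-- The semigroup `(S, ⊔)`. -/
abbrev supSemigroup (S : Type u) [SkewLattice S] : Semigroup S where
  mul x y := x ⊔ y
  mul_assoc := sup_assoc

/-- Half of the relation `𝒟`. -/
def Below (x y : S) : Prop := x ⊓ y ⊓ x = x

theorem Below.refl (x : S) : Below x x := by simp [Below, inf_idem]

theorem Below.trans {x y z : S} (h : Below x y) (h' : Below y z) : Below x z :=
  @band_trans S (infSemigroup S) inf_idem _ _ _ h h'

theorem below_inf {w x y : S} (h : Below w x) (h' : Below w y) : Below w (x ⊓ y) :=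
  @band_meet S (infSemigroup S) inf_idem _ _ _ h h'

theorem inf_below_left (x y : S) : Below (x ⊓ y) x :=
  @band_left S (infSemigroup S) inf_idem _ _

theorem inf_below_right (x y : S) : Below (x ⊓ y) y :=
  @band_right S (infSemigroup S) inf_idem _ _

theorem below_iff_sup {x y : S} : Below x y ↔ y ⊔ x ⊔ y = y := by
  constructor
  · intro h
    have h1 := sup_inf_absorb (x ⊓ y) x
    rw [show x ⊓ y ⊓ x = x from h] at h1
    refine @band_below S (supSemigroup S) sup_idem y (x ⊓ y) x y ?_
    change y = (x ⊓ y) ⊔ x ⊔ y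
    rw [h1, inf_sup_absorb']
  · intro h
    have h1 : (y ⊔ x) ⊓ y = y ⊔ x := by
      nth_rw 2 [← h]
      exact inf_sup_absorb _ _
    refine @band_below S (infSemigroup S) inf_idem x (y ⊔ x) y x ?_
    change x = (y ⊔ x) ⊓ y ⊓ x
    rw [h1, sup_inf_absorb']

theorem sup_below {w x y : S} (h : Below x w) (h' : Below y w) : Below (x ⊔ y) w := by
  rw [below_iff_sup] at *
  exact @band_meet S (supSemigroup S) sup_idem _ _ _ h h'

theorem below_sup_left (x y : S) : Below x (x ⊔ y) :=
  below_iff_sup.2 (@band_left S (supSemigroup S) sup_idem _ _)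

theorem below_sup_right (x y : S) : Below y (x ⊔ y) :=
  below_iff_sup.2 (@band_right S (supSemigroup S) sup_idem _ _)

/-- The equivalence relation `𝒟`: `x 𝒟 y` if and only if `x ⊓ y ⊓ x = x` and `y ⊓ x ⊓ y = y`. -/
def dSetoid (S : Type u) [SkewLattice S] : Setoid S where
  r x y := x ⊓ y ⊓ x = x ∧ y ⊓ x ⊓ y = y
  iseqv :=
    { refl := fun x => ⟨Below.refl x, Below.refl x⟩
      symm := fun h => ⟨h.2, h.1⟩
      trans := fun h h' => ⟨Below.trans h.1 h'.1, Below.trans h'.2 h.2⟩ }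

/-- The lattice reflection `S/𝒟`. -/
def DQuot (S : Type u) [SkewLattice S] : Type u := Quotient (dSetoid S)

/-- The class of an element in `S/𝒟`. -/
def toD (x : S) : DQuot S := Quotient.mk (dSetoid S) x

theorem toD_eq_iff {x y : S} : toD x = toD y ↔ x ⊓ y ⊓ x = x ∧ y ⊓ x ⊓ y = y :=
  Quotient.eq (r := dSetoid S)

instance : Min (DQuot S) where
  min := Quotient.map₂ (· ⊓ ·) fun _ _ h _ _ h' =>
    ⟨below_inf ((inf_below_left _ _).trans h.1) ((inf_below_right _ _).trans h'.1),
      below_inf ((inf_below_left _ _).trans h.2) ((inf_below_right _ _).trans h'.2)⟩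

instance : Max (DQuot S) where
  max := Quotient.map₂ (· ⊔ ·) fun _ _ h _ _ h' =>
    ⟨sup_below (Below.trans h.1 (below_sup_left _ _)) (Below.trans h'.1 (below_sup_right _ _)),
      sup_below (Below.trans h.2 (below_sup_left _ _)) (Below.trans h'.2 (below_sup_right _ _))⟩

theorem toD_inf (x y : S) : toD (x ⊓ y) = toD x ⊓ toD y := rfl

theorem toD_sup (x y : S) : toD (x ⊔ y) = toD x ⊔ toD y := rfl

theorem toD_surjective : Function.Surjective (toD : S → DQuot S) := Quotient.mk_surjective

/-- The lattice structure of `S/𝒟`, with the operations induced by those of `S`. -/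
instance : Lattice (DQuot S) :=
  Lattice.mk'
    (by
      intro a b
      obtain ⟨x, rfl⟩ := toD_surjective a
      obtain ⟨y, rfl⟩ := toD_surjective b
      exact toD_eq_iff.2 ⟨sup_below (below_sup_right _ _) (below_sup_left _ _),
        sup_below (below_sup_right _ _) (below_sup_left _ _)⟩)
    (by
      intro a b c
      obtain ⟨x, rfl⟩ := toD_surjective a
      obtain ⟨y, rfl⟩ := toD_surjective b
      obtain ⟨z, rfl⟩ := toD_surjective c
      simp only [← toD_sup, sup_assoc])
    (by
      intro a b
      obtain ⟨x, rfl⟩ := toD_surjective a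
      obtain ⟨y, rfl⟩ := toD_surjective b
      exact toD_eq_iff.2 ⟨below_inf (inf_below_right _ _) (inf_below_left _ _),
        below_inf (inf_below_right _ _) (inf_below_left _ _)⟩)
    (by
      intro a b c
      obtain ⟨x, rfl⟩ := toD_surjective a
      obtain ⟨y, rfl⟩ := toD_surjective b
      obtain ⟨z, rfl⟩ := toD_surjective c
      simp only [← toD_inf, inf_assoc])
    (by
      intro a b
      obtain ⟨x, rfl⟩ := toD_surjective a
      obtain ⟨y, rfl⟩ := toD_surjective b
      simp only [← toD_inf, ← toD_sup, sup_inf_absorb])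
    (by
      intro a b
      obtain ⟨x, rfl⟩ := toD_surjective a
      obtain ⟨y, rfl⟩ := toD_surjective b
      simp only [← toD_inf, ← toD_sup, inf_sup_absorb])

theorem toD_le_iff {x y : S} : toD x ≤ toD y ↔ x ⊓ y ⊓ x = x := by
  rw [← inf_eq_left]
  refine (toD_eq_iff (x := x ⊓ y) (y := x)).trans ⟨fun h => ?_, fun h =>
    ⟨inf_below_left _ _, below_inf (Below.refl _) h⟩⟩
  exact (show Below x (x ⊓ y) from h.2).trans (inf_below_right _ _)

/-- Homomorphisms of skew lattices with zero. -/
@[ext]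
structure Hom (S : Type u) (T : Type v) [SkewLattice S] [SkewLattice T] where
  toFun : S → T
  map_inf (x y : S) : toFun (x ⊓ y) = toFun x ⊓ toFun y
  map_sup (x y : S) : toFun (x ⊔ y) = toFun x ⊔ toFun y
  map_zero : toFun 0 = 0

variable {T : Type v} [SkewLattice T]

/-- The map `S/𝒟 → T/𝒟` induced by a homomorphism. -/
def Hom.bar (h : Hom S T) : DQuot S → DQuot T :=
  Quotient.map h.toFun fun x y hxy => by
    constructor
    · rw [← h.map_inf, ← h.map_inf, hxy.1]
    · rw [← h.map_inf, ← h.map_inf, hxy.2]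

theorem Hom.bar_toD (h : Hom S T) (x : S) : h.bar (toD x) = toD (h.toFun x) := rfl

/-- A homomorphism is proper if every element of `T/𝒟` lies below a value of the induced map
`S/𝒟 → T/𝒟`. -/
def Hom.IsProper (h : Hom S T) : Prop := ∀ y : DQuot T, ∃ x : DQuot S, y ≤ h.bar x

end SkewLattice

/-- Left-handed strongly distributive skew lattices with zero. -/
structure DSL : Type (u + 1) where
  carrier : Type u
  [skewLattice : SkewLattice carrier]
  [stronglyDistributive : SkewLattice.IsStronglyDistributive carrier]
  [leftHanded : SkewLattice.IsLeftHanded carrier]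

namespace DSL

attribute [instance] skewLattice stronglyDistributive leftHanded

/-- Proper homomorphisms. -/
@[ext]
structure Hom (S T : DSL.{u}) extends SkewLattice.Hom S.carrier T.carrier where
  proper : toHom.IsProper

instance : Category.{u} DSL.{u} where
  Hom := Hom
  id S :=
    { toFun := id
      map_inf := fun _ _ => rfl
      map_sup := fun _ _ => rfl
      map_zero := rfl
      proper := fun y => ⟨y, by
        obtain ⟨x, rfl⟩ := SkewLattice.toD_surjective y
        exact le_refl _⟩ }
  comp h k :=
    { toFun := k.toFun ∘ h.toFun
      map_inf := fun x y => by simp [h.map_inf, k.map_inf]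
      map_sup := fun x y => by simp [h.map_sup, k.map_sup]
      map_zero := by simp [h.map_zero, k.map_zero]
      proper := fun z => by
        obtain ⟨y, hy⟩ := k.proper z
        obtain ⟨x, hx⟩ := h.proper y
        obtain ⟨z, rfl⟩ := SkewLattice.toD_surjective z
        obtain ⟨y, rfl⟩ := SkewLattice.toD_surjective y
        obtain ⟨x, rfl⟩ := SkewLattice.toD_surjective x
        refine ⟨SkewLattice.toD x, hy.trans ?_⟩
        rw [SkewLattice.Hom.bar_toD, SkewLattice.toD_le_iff] at hx
        refine SkewLattice.toD_le_iff.2 ?_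
        change k.toFun y ⊓ k.toFun (h.toFun x) ⊓ k.toFun y = k.toFun y
        rw [← k.map_inf, ← k.map_inf, hx] }

end DSL

/-- The order of the ordered one-point-compactification: `∞` is added as a maximum. -/
instance OnePoint.instPartialOrderTop (X : Type u) [PartialOrder X] : PartialOrder (OnePoint X) where
  le p q := q = ∞ ∨ ∃ x y : X, x ≤ y ∧ p = x ∧ q = y
  le_refl p := by
    induction p using OnePoint.rec with
    | infty => exact Or.inl rfl
    | coe x => exact Or.inr ⟨x, x, le_refl x, rfl, rfl⟩
  le_trans p q r := by
    rintro (rfl | ⟨x, y, h, rfl, rfl⟩) (rfl | ⟨y', z, h', e, rfl⟩)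
    · exact Or.inl rfl
    · exact absurd e (OnePoint.infty_ne_coe _)
    · exact Or.inl rfl
    · exact Or.inr ⟨x, z, h.trans (OnePoint.coe_eq_coe.1 e ▸ h'), rfl, rfl⟩
  le_antisymm p q := by
    rintro (rfl | ⟨x, y, h, rfl, rfl⟩) (h' | ⟨y', z, h', e, e'⟩)
    · exact h'
    · exact absurd e (OnePoint.infty_ne_coe _)
    · exact absurd h' (OnePoint.coe_ne_infty _)
    · rw [OnePoint.coe_eq_coe] at e e' ⊢
      subst e e'
      exact le_antisymm h h'

namespace OnePoint

variable {X : Type u} [PartialOrder X]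

theorem coe_le_coe_iff {x y : X} : (x : OnePoint X) ≤ (y : OnePoint X) ↔ x ≤ y := by
  constructor
  · rintro (h | ⟨a, b, h, e, e'⟩)
    · exact absurd h (OnePoint.coe_ne_infty _)
    · rwa [OnePoint.coe_eq_coe.1 e, OnePoint.coe_eq_coe.1 e']
  · exact fun h => Or.inr ⟨x, y, h, rfl, rfl⟩

theorem le_infinity (p : OnePoint X) : p ≤ ∞ := Or.inl rfl

theorem not_infinity_le_coe (x : X) : ¬ (∞ : OnePoint X) ≤ x := by
  rintro (h | ⟨a, b, h, e, e'⟩)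
  · exact OnePoint.coe_ne_infty _ h
  · exact OnePoint.infty_ne_coe _ e

end OnePoint

/-- A local Priestley space: a partially ordered topological space whose ordered
one-point-compactification is a Priestley space. -/
class LocalPriestleySpace (X : Type u) [TopologicalSpace X] [PartialOrder X] : Prop where
  compactSpace : CompactSpace (OnePoint X)
  priestley : PriestleySpace (OnePoint X)

namespace LocalPriestleySpace

attribute [instance] priestley

variable (X : Type u) [TopologicalSpace X] [PartialOrder X] [LocalPriestleySpace X]

instance : T2Space X := OnePoint.isOpenEmbedding_coe.isEmbedding.t2Space

variable {X}

theorem exists_compact_open_downset (x : X) :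
    ∃ U : Set X, IsOpen U ∧ IsCompact U ∧ IsLowerSet U ∧ x ∈ U := by
  obtain ⟨V, hV, hl, hi, hx⟩ :=
    exists_isClopen_lower_of_not_le (OnePoint.not_infinity_le_coe x)
  refine ⟨((↑) : X → OnePoint X) ⁻¹' V, hV.isOpen.preimage OnePoint.continuous_coe, ?_, ?_, hx⟩
  · exact ((OnePoint.isClosed_iff_of_notMem hi).1 hV.isClosed).2
  · exact fun a b h ha => hl (OnePoint.coe_le_coe_iff.2 h) ha

/-- Every neighbourhood of a point contains a compact open neighbourhood. -/
theorem exists_compact_open_subset {x : X} {W : Set X} (hW : IsOpen W) (hx : x ∈ W) :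
    ∃ U : Set X, IsOpen U ∧ IsCompact U ∧ U ⊆ W ∧ x ∈ U := by
  obtain ⟨V, hV, hxV, hVW⟩ := compact_exists_isClopen_in_isOpen
    (OnePoint.isOpen_image_coe.2 hW) (Set.mem_image_of_mem ((↑) : X → OnePoint X) hx)
  have hi : ∞ ∉ V := fun h => by
    obtain ⟨y, -, hy⟩ := hVW h
    exact OnePoint.coe_ne_infty _ hy
  refine ⟨((↑) : X → OnePoint X) ⁻¹' V, hV.isOpen.preimage OnePoint.continuous_coe,
    ((OnePoint.isClosed_iff_of_notMem hi).1 hV.isClosed).2, fun y hy => ?_, hxV⟩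
  obtain ⟨z, hz, e⟩ := hVW hy
  rwa [← OnePoint.coe_eq_coe.1 e]

end LocalPriestleySpace

/-- Local Priestley spaces. -/
structure LPS : Type (u + 1) where
  carrier : Type u
  [topology : TopologicalSpace carrier]
  [order : PartialOrder carrier]
  [localPriestley : LocalPriestleySpace carrier]

namespace LPS

attribute [instance] topology order localPriestley

/-- The underlying topological space. -/
abbrev toTop (X : LPS.{u}) : TopCat.{u} := TopCat.of X.carrier

/-- A morphism of local Priestley spaces is a map `f` whose extension `OnePoint.map f` to the
one-point-compactifications, which maps `X` into `Y` and `∞` to `∞`, is continuous and monotone. -/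
@[ext]
structure Hom (X Y : LPS.{u}) where
  toFun : X.carrier → Y.carrier
  continuous_map : Continuous (OnePoint.map toFun)
  monotone_map : Monotone (OnePoint.map toFun)

instance : Category.{u} LPS.{u} where
  Hom := Hom
  id X :=
    { toFun := id
      continuous_map := by rw [OnePoint.map_id]; exact continuous_id
      monotone_map := by rw [OnePoint.map_id]; exact monotone_id }
  comp f g :=
    { toFun := g.toFun ∘ f.toFun
      continuous_map := by
        rw [OnePoint.map_comp]; exact g.continuous_map.comp f.continuous_map
      monotone_map := by
        rw [OnePoint.map_comp]; exact g.monotone_map.comp f.monotone_map }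

variable {X Y : LPS.{u}}

theorem Hom.continuous (f : Hom X Y) : Continuous f.toFun :=
  (OnePoint.continuous_map_iff.1 f.continuous_map).1

theorem Hom.monotone (f : Hom X Y) : Monotone f.toFun := fun x y h => by
  have := f.monotone_map (OnePoint.coe_le_coe_iff.2 h)
  exact OnePoint.coe_le_coe_iff.1 this

theorem Hom.isCompact_preimage (f : Hom X Y) {K : Set Y.carrier} (hK : IsCompact K) :
    IsCompact (f.toFun ⁻¹' K) := by
  have := (OnePoint.continuous_map_iff.1 f.continuous_map).2
  have h := Filter.mem_coclosedCompact_iff.1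
    (this (Filter.mem_coclosedCompact_iff.2 (by rwa [compl_compl, hK.isClosed.closure_eq]) :
      Kᶜ ∈ Filter.coclosedCompact Y.carrier))
  rw [Set.preimage_compl, compl_compl] at h
  rwa [(hK.isClosed.preimage f.continuous).closure_eq] at h

/-- The underlying continuous map. -/
def Hom.top (f : Hom X Y) : X.toTop ⟶ Y.toTop := TopCat.ofHom ⟨f.toFun, f.continuous⟩

end LPS

/-- The compact open downsets of a local Priestley space. -/
@[ext]
structure CompactOpenDownset (X : LPS.{u}) : Type u where
  toOpens : Opens X.toTop
  isCompact : IsCompact (toOpens : Set X.carrier)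
  isLowerSet : IsLowerSet (toOpens : Set X.carrier)

namespace CompactOpenDownset

variable {X : LPS.{u}}

instance : Min (CompactOpenDownset X) where
  min U V := ⟨U.1 ⊓ V.1, U.2.inter_right V.2.isClosed, U.3.inter V.3⟩

instance : Max (CompactOpenDownset X) where
  max U V := ⟨U.1 ⊔ V.1, U.2.union V.2, U.3.union V.3⟩

instance : Bot (CompactOpenDownset X) where
  bot := ⟨⊥, isCompact_empty, isLowerSet_empty⟩

/-- The difference of two compact open downsets, an open set. -/
def diff (U V : CompactOpenDownset X) : Opens X.toTop :=
  ⟨(U.1 : Set X.carrier) \ V.1, U.1.isOpen.sdiff V.2.isClosed⟩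

/-- The inverse image of a compact open downset under a morphism. -/
def comap {Y : LPS.{u}} (f : X ⟶ Y) (U : CompactOpenDownset Y) : CompactOpenDownset X :=
  ⟨(Opens.map (LPS.Hom.top f)).obj U.1, LPS.Hom.isCompact_preimage f U.2,
    U.3.preimage (LPS.Hom.monotone f)⟩

end CompactOpenDownset

/-- Sheaves of sets over local Priestley spaces, all of whose stalks are nonempty. -/
structure ShLPS : Type (u + 1) where
  base : LPS.{u}
  sheaf : TopCat.Sheaf (Type u) base.toTop
  nonempty_stalk : ∀ x : base.toTop, Nonempty (sheaf.presheaf.stalk x)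

namespace ShLPS

/-- A morphism from `(X, E)` to `(Y, F)` is a pair of a morphism `f : X ⟶ Y` of local Priestley
spaces and a natural transformation `F ⟶ f_* E`. -/
@[ext]
structure Hom (E F : ShLPS.{u}) where
  base : E.base ⟶ F.base
  nat : F.sheaf.presheaf ⟶
    (TopCat.Presheaf.pushforward (Type u) (LPS.Hom.top base)).obj E.sheaf.presheaf

/-- The composite of `(f, lam)` and `(g, mu)` is `(g ∘ f, sigma)` with
`sigma_U = lam_{g⁻¹ U} ∘ mu_U`. -/
instance : Category.{u} ShLPS.{u} where
  Hom := Hom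
  id E := { base := 𝟙 E.base, nat := 𝟙 E.sheaf.presheaf }
  comp {E F G} φ ψ :=
    { base := φ.base ≫ ψ.base
      nat := ψ.nat ≫
        (TopCat.Presheaf.pushforward (Type u) (LPS.Hom.top ψ.base)).map φ.nat }
  id_comp φ := Hom.ext rfl (heq_of_eq (by ext; rfl))
  comp_id φ := Hom.ext rfl (heq_of_eq (by ext; rfl))
  assoc φ ψ χ := Hom.ext rfl (heq_of_eq (by ext; rfl))


/-- The set of sections of `E` over an open set. -/
abbrev Sec (E : ShLPS.{u}) (U : Opens E.base.toTop) : Type u := E.sheaf.presheaf.obj (op U)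

/-- Restriction of sections. -/
abbrev res (E : ShLPS.{u}) {U V : Opens E.base.toTop} (h : U ≤ V) (s : E.Sec V) : E.Sec U :=
  E.sheaf.presheaf.map (homOfLE h).op s

/-- The germ of a section. -/
noncomputable abbrev germ (E : ShLPS.{u}) (U : Opens E.base.toTop) (x : E.base.toTop) (hx : x ∈ U)
    (s : E.Sec U) : E.sheaf.presheaf.stalk x :=
  E.sheaf.presheaf.germ U x hx s

theorem germ_res (E : ShLPS.{u}) {U V : Opens E.base.toTop} (h : U ≤ V) (s : E.Sec V)
    (x : E.base.toTop) (hx : x ∈ U) : E.germ U x hx (E.res h s) = E.germ V x (h hx) s :=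
  TopCat.Presheaf.germ_res_apply _ _ _ _ _

theorem sec_ext (E : ShLPS.{u}) {U : Opens E.base.toTop} {s t : E.Sec U}
    (h : ∀ x hx, E.germ U x hx s = E.germ U x hx t) : s = t :=
  TopCat.Presheaf.section_ext E.sheaf U s t h

/-- There is exactly one section over the empty set. -/
theorem existsUnique_sec_bot (E : ShLPS.{u}) : ∃! _s : E.Sec ⊥, True := by
  obtain ⟨s, -, hs⟩ := E.sheaf.existsUnique_gluing' (ι := PEmpty.{1}) (fun _ => ⊥) ⊥
    (fun i => i.elim) bot_le (fun i => i.elim) (fun i => i.elim)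
  exact ⟨s, trivial, fun t _ => hs t fun i => i.elim⟩

/-- Sections over two disjoint open sets that cover `W` have a unique patch. -/
theorem existsUnique_patch (E : ShLPS.{u}) {U V W : Opens E.base.toTop} (hU : U ≤ W) (hV : V ≤ W)
    (hW : ∀ x ∈ W, x ∈ U ∨ x ∈ V) (hd : ∀ x, x ∈ U → x ∉ V) (s : E.Sec U) (t : E.Sec V) :
    ∃! r : E.Sec W, E.res hU r = s ∧ E.res hV r = t := by
  let A : Bool → Opens E.base.toTop := fun i => bif i then U else V
  have hA : ∀ i, A i ≤ W := by rintro (_ | _) <;> assumption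
  let f : ∀ i, E.Sec (A i) := fun i =>
    match i with
    | true => s
    | false => t
  obtain ⟨r, hr, hu⟩ := E.sheaf.existsUnique_gluing' A W (fun i => homOfLE (hA i))
    (fun x hx => by
      rw [Opens.mem_iSup]
      exact (hW x hx).elim (fun h => ⟨true, h⟩) (fun h => ⟨false, h⟩)) f
    (by
      rintro (_ | _) (_ | _)
      · rfl
      · exact E.sec_ext fun x hx => absurd hx.1 (hd x hx.2)
      · exact E.sec_ext fun x hx => absurd hx.2 (hd x hx.1)
      · rfl)
  exact ⟨r, ⟨hr true, hr false⟩, fun r' h => hu r' (by rintro (_ | _); exacts [h.2, h.1])⟩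

/-- The override of two sections `a` and `b` over `U` and `V`: the section over `U ∪ V` that
restricts to `b` on `V` and to `a` on `U \ V`. -/
theorem existsUnique_override (E : ShLPS.{u}) {U V : CompactOpenDownset E.base}
    (a : E.Sec U.1) (b : E.Sec V.1) :
    ∃! r : E.Sec (U ⊔ V).1,
      E.res (show U.diff V ≤ (U ⊔ V).1 from fun _ hx => Or.inl hx.1) r =
        E.res (show U.diff V ≤ U.1 from fun _ hx => hx.1) a ∧
      E.res (show V.1 ≤ (U ⊔ V).1 from fun _ hx => Or.inr hx) r = b :=
  E.existsUnique_patch _ _ (fun x hx => by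
    by_cases h : x ∈ V.1
    · exact Or.inr h
    · exact Or.inl ⟨hx.resolve_right h, h⟩) (fun x (hx : x ∈ U.diff V) => hx.2) _ _

/-- The carrier of the dual algebra `E*`: the local sections over compact open downsets. -/
structure DualAlgebra (E : ShLPS.{u}) : Type u where
  dom : CompactOpenDownset E.base
  sec : E.Sec dom.1

namespace DualAlgebra

variable {E F G : ShLPS.{u}}

/-- The restriction of `a` to the intersection of the domains. -/
instance : Min E.DualAlgebra where
  min a b := ⟨a.dom ⊓ b.dom, E.res (show (a.dom ⊓ b.dom).1 ≤ a.dom.1 from fun _ hx => hx.1) a.sec⟩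

/-- The override of `a` by `b`. -/
noncomputable instance : Max E.DualAlgebra where
  max a b := ⟨a.dom ⊔ b.dom, (E.existsUnique_override a.sec b.sec).choose⟩

/-- The section over the empty set. -/
noncomputable instance : Zero E.DualAlgebra where
  zero := ⟨⊥, E.existsUnique_sec_bot.choose⟩

open Classical in
/-- The value at `x` of a local section, viewed as a partial function. -/
noncomputable def ev (a : E.DualAlgebra) (x : E.base.toTop) : Option (E.sheaf.presheaf.stalk x) :=
  if h : x ∈ a.dom.1 then some (E.germ _ x h a.sec) else none

theorem ev_of_mem {a : E.DualAlgebra} {x : E.base.toTop} (h : x ∈ a.dom.1) :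
    a.ev x = some (E.germ _ x h a.sec) := dif_pos h

theorem ev_of_notMem {a : E.DualAlgebra} {x : E.base.toTop} (h : x ∉ a.dom.1) :
    a.ev x = none := dif_neg h

theorem ev_ext {a b : E.DualAlgebra} (h : ∀ x, a.ev x = b.ev x) : a = b := by
  obtain ⟨U, s⟩ := a
  obtain ⟨V, t⟩ := b
  obtain rfl : U = V := by
    refine CompactOpenDownset.ext (Opens.ext (Set.ext fun x => ?_))
    have := h x
    by_cases h1 : x ∈ U.1 <;> by_cases h2 : x ∈ V.1
    · exact ⟨fun _ => h2, fun _ => h1⟩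
    · rw [ev_of_mem h1, ev_of_notMem h2] at this
      simp at this
    · rw [ev_of_notMem h1, ev_of_mem h2] at this
      simp at this
    · exact ⟨fun h => absurd h h1, fun h => absurd h h2⟩
  congr
  refine E.sec_ext fun x hx => ?_
  have := h x
  rw [ev_of_mem (a := ⟨U, s⟩) hx, ev_of_mem (a := ⟨U, t⟩) hx] at this
  exact Option.some.inj this

theorem ev_inf (a b : E.DualAlgebra) (x : E.base.toTop) :
    (a ⊓ b).ev x = (b.ev x).bind fun _ => a.ev x := by
  by_cases h2 : x ∈ b.dom.1
  · by_cases h1 : x ∈ a.dom.1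
    · have h : x ∈ (a ⊓ b).dom.1 := ⟨h1, h2⟩
      rw [ev_of_mem h, ev_of_mem h2, ev_of_mem h1]
      exact congrArg some (E.germ_res _ _ _ _)
    · have h : x ∉ (a ⊓ b).dom.1 := fun h => h1 h.1
      rw [ev_of_notMem h, ev_of_mem h2, ev_of_notMem h1]
      rfl
  · have h : x ∉ (a ⊓ b).dom.1 := fun h => h2 h.2
    rw [ev_of_notMem h, ev_of_notMem h2]
    rfl

theorem ev_sup (a b : E.DualAlgebra) (x : E.base.toTop) :
    (a ⊔ b).ev x = (b.ev x).or (a.ev x) := by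
  have hs := (E.existsUnique_override a.sec b.sec).choose_spec.1
  by_cases h2 : x ∈ b.dom.1
  · have h : x ∈ (a ⊔ b).dom.1 := Or.inr h2
    rw [ev_of_mem h, ev_of_mem h2, Option.some_or]
    refine congrArg some (Eq.trans ?_ (congrArg (E.germ _ x h2) hs.2))
    exact (E.germ_res (show b.dom.1 ≤ (a.dom ⊔ b.dom).1 from fun _ hx => Or.inr hx)
      (E.existsUnique_override a.sec b.sec).choose x h2).symm
  · rw [ev_of_notMem h2, Option.none_or]
    by_cases h1 : x ∈ a.dom.1
    · have h : x ∈ (a ⊔ b).dom.1 := Or.inl h1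
      have h3 : x ∈ a.dom.diff b.dom := ⟨h1, h2⟩
      rw [ev_of_mem h, ev_of_mem h1]
      refine congrArg some (Eq.trans ?_ ((congrArg (E.germ _ x h3) hs.1).trans ?_))
      · exact (E.germ_res (show a.dom.diff b.dom ≤ (a.dom ⊔ b.dom).1 from fun _ hx => Or.inl hx.1)
        (E.existsUnique_override a.sec b.sec).choose x h3).symm
      · exact E.germ_res _ _ x h3
    · have h : x ∉ (a ⊔ b).dom.1 := fun h => h.elim h1 h2
      rw [ev_of_notMem h, ev_of_notMem h1]

theorem ev_zero (x : E.base.toTop) : (0 : E.DualAlgebra).ev x = none :=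
  ev_of_notMem fun h => h

noncomputable instance : SkewLattice E.DualAlgebra where
  inf_assoc a b c := ev_ext fun x => by
    simp only [ev_inf]
    cases a.ev x <;> cases b.ev x <;> cases c.ev x <;> rfl
  sup_assoc a b c := ev_ext fun x => by
    simp only [ev_sup]
    cases a.ev x <;> cases b.ev x <;> cases c.ev x <;> rfl
  inf_idem a := ev_ext fun x => by
    simp only [ev_inf]
    cases a.ev x <;> rfl
  sup_idem a := ev_ext fun x => by
    simp only [ev_sup]
    cases a.ev x <;> rfl
  inf_sup_absorb a b := ev_ext fun x => by
    simp only [ev_inf, ev_sup]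
    cases a.ev x <;> cases b.ev x <;> rfl
  sup_inf_absorb a b := ev_ext fun x => by
    simp only [ev_inf, ev_sup]
    cases a.ev x <;> cases b.ev x <;> rfl
  sup_inf_absorb' a b := ev_ext fun x => by
    simp only [ev_inf, ev_sup]
    cases a.ev x <;> cases b.ev x <;> rfl
  inf_sup_absorb' a b := ev_ext fun x => by
    simp only [ev_inf, ev_sup]
    cases a.ev x <;> cases b.ev x <;> rfl
  inf_zero a := ev_ext fun x => by
    simp only [ev_inf, ev_zero]
    rfl
  zero_inf a := ev_ext fun x => by
    simp only [ev_inf, ev_zero]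
    cases a.ev x <;> rfl

instance : SkewLattice.IsStronglyDistributive E.DualAlgebra where
  inf_sup a b c := ev_ext fun x => by
    simp only [ev_inf, ev_sup]
    cases a.ev x <;> cases b.ev x <;> cases c.ev x <;> rfl
  sup_inf a b c := ev_ext fun x => by
    simp only [ev_inf, ev_sup]
    cases a.ev x <;> cases b.ev x <;> cases c.ev x <;> rfl

instance : SkewLattice.IsLeftHanded E.DualAlgebra where
  inf_inf a b := ev_ext fun x => by
    simp only [ev_inf]
    cases a.ev x <;> cases b.ev x <;> rfl

/-- The map `F* → E*` induced by a morphism `(f, lam)` from `E` to `F`: it sends `a ∈ F(U)` to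
`lam_U (a) ∈ E(f⁻¹ U)`. -/
def map (φ : E ⟶ F) (a : F.DualAlgebra) : E.DualAlgebra :=
  ⟨a.dom.comap (Hom.base φ), (Hom.nat φ).app (op a.dom.1) a.sec⟩

/-- The map of stalks induced by a morphism. -/
theorem exists_stalkMap (φ : E ⟶ F) (x : E.base.toTop) :
    ∃ k : F.sheaf.presheaf.stalk (LPS.Hom.top (Hom.base φ) x) → E.sheaf.presheaf.stalk x,
      ∀ a : F.DualAlgebra, (map φ a).ev x = (a.ev (LPS.Hom.top (Hom.base φ) x)).map k := by
  refine ⟨fun t => E.sheaf.presheaf.stalkPushforward (Type u) (LPS.Hom.top (Hom.base φ)) x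
    ((TopCat.Presheaf.stalkFunctor (Type u) _).map (Hom.nat φ) t), fun a => ?_⟩
  by_cases h : LPS.Hom.top (Hom.base φ) x ∈ a.dom.1
  · rw [ev_of_mem h, ev_of_mem (a := map φ a) (x := x) h, Option.map_some]
    refine congrArg some ?_
    rw [TopCat.Presheaf.stalkFunctor_map_germ_apply]
    exact (ConcreteCategory.congr_hom (TopCat.Presheaf.stalkPushforward_germ (Type u)
      (LPS.Hom.top (Hom.base φ)) E.sheaf.presheaf a.dom.1 x h) _).symm
  · rw [ev_of_notMem h, ev_of_notMem (a := map φ a) (x := x) h, Option.map_none]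

/-- Every compact open downset carries a section. -/
theorem exists_sec (U : Opens E.base.toTop) (hU : IsCompact (U : Set E.base.carrier)) :
    Nonempty (E.Sec U) := by
  have key : ∃ K : Opens E.base.toTop, (U : Set E.base.carrier) ⊆ K ∧
      IsCompact (K : Set E.base.carrier) ∧ Nonempty (E.Sec K) := by
    refine hU.induction_on (p := fun s => ∃ K : Opens E.base.toTop, s ⊆ (K : Set E.base.carrier) ∧
      IsCompact (K : Set E.base.carrier) ∧ Nonempty (E.Sec K)) ?_ ?_ ?_ ?_
    · exact ⟨⊥, Set.empty_subset _, isCompact_empty, ⟨E.existsUnique_sec_bot.choose⟩⟩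
    · rintro s t h ⟨K, hK, h'⟩
      exact ⟨K, h.trans hK, h'⟩
    · rintro s t ⟨K, hK, hc, ⟨a⟩⟩ ⟨L, hL, hd, ⟨b⟩⟩
      let D : Opens E.base.toTop :=
        ⟨(K : Set E.base.carrier) \ L, K.isOpen.sdiff hd.isClosed⟩
      have hD : D ≤ K := fun x hx => hx.1
      refine ⟨K ⊔ L, Set.union_subset_union hK hL, hc.union hd,
        ⟨(E.existsUnique_patch (U := D) (V := L) (W := K ⊔ L) (hD.trans le_sup_left) le_sup_right
          (fun x hx => ?_) (fun x hx => hx.2) (E.res hD a) b).choose⟩⟩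
      by_cases h : x ∈ L
      · exact Or.inr h
      · exact Or.inl ⟨(show x ∈ K ∨ x ∈ L from hx).resolve_right h, h⟩
    · intro x _
      obtain ⟨t⟩ := E.nonempty_stalk x
      obtain ⟨W, hx, s, -⟩ := TopCat.Presheaf.exists_germ_eq E.sheaf.presheaf t
      obtain ⟨K, hKo, hKc, hKW, hxK⟩ :=
        LocalPriestleySpace.exists_compact_open_subset (X := E.base.carrier) W.isOpen hx
      exact ⟨K, mem_nhdsWithin_of_mem_nhds (hKo.mem_nhds hxK),
        ⟨K, hKo⟩, subset_rfl, hKc, ⟨E.res (show (⟨K, hKo⟩ : Opens E.base.toTop) ≤ W from hKW) s⟩⟩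
  obtain ⟨K, hK, -, ⟨s⟩⟩ := key
  exact ⟨E.res (show U ≤ K from hK) s⟩

theorem toD_le_iff_dom {a b : E.DualAlgebra} :
    SkewLattice.toD a ≤ SkewLattice.toD b ↔ (a.dom.1 : Set E.base.carrier) ⊆ b.dom.1 := by
  rw [SkewLattice.toD_le_iff]
  constructor
  · intro h x hx
    rw [← h] at hx
    exact hx.1.2
  · intro h
    refine ev_ext fun x => ?_
    simp only [ev_inf]
    by_cases h1 : x ∈ a.dom.1
    · rw [ev_of_mem h1, ev_of_mem (h h1)]; rfl
    · rw [ev_of_notMem h1]; rfl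

theorem exists_le_comap (f : E.base ⟶ F.base) (U : CompactOpenDownset E.base) :
    ∃ V : CompactOpenDownset F.base, U.1 ≤ (V.comap f).1 := by
  refine U.2.induction_on (p := fun s => ∃ V : CompactOpenDownset F.base,
    s ⊆ ((V.comap f).1 : Set E.base.carrier)) ?_ ?_ ?_ ?_
  · exact ⟨⊥, Set.empty_subset _⟩
  · rintro s t h ⟨V, hV⟩
    exact ⟨V, h.trans hV⟩
  · rintro s t ⟨V, hV⟩ ⟨W, hW⟩
    exact ⟨V ⊔ W, Set.union_subset_union hV hW⟩
  · intro x _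
    obtain ⟨V, ho, hc, hl, hx⟩ :=
      LocalPriestleySpace.exists_compact_open_downset (LPS.Hom.top f x)
    let V' : CompactOpenDownset F.base := ⟨⟨V, ho⟩, hc, hl⟩
    exact ⟨_, mem_nhdsWithin_of_mem_nhds ((V'.comap f).1.isOpen.mem_nhds hx), V', subset_rfl⟩

/-- The homomorphism `F* → E*` induced by a morphism from `E` to `F`. -/
def mapHom (φ : E ⟶ F) : SkewLattice.Hom F.DualAlgebra E.DualAlgebra where
  toFun := map φ
  map_inf a b := ev_ext fun x => by
    obtain ⟨k, hk⟩ := exists_stalkMap φ x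
    simp only [ev_inf, hk]
    cases a.ev (LPS.Hom.top (Hom.base φ) x) <;> cases b.ev (LPS.Hom.top (Hom.base φ) x) <;> rfl
  map_sup a b := ev_ext fun x => by
    obtain ⟨k, hk⟩ := exists_stalkMap φ x
    simp only [ev_sup, hk]
    cases a.ev (LPS.Hom.top (Hom.base φ) x) <;> cases b.ev (LPS.Hom.top (Hom.base φ) x) <;> rfl
  map_zero := ev_ext fun x => by
    obtain ⟨k, hk⟩ := exists_stalkMap φ x
    simp only [ev_zero, hk]
    rfl

theorem mapHom_isProper (φ : E ⟶ F) : (mapHom φ).IsProper := by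
  intro c
  obtain ⟨a, rfl⟩ := SkewLattice.toD_surjective c
  obtain ⟨V, hV⟩ := exists_le_comap (Hom.base φ) a.dom
  obtain ⟨t⟩ := exists_sec V.1 V.2
  exact ⟨SkewLattice.toD ⟨V, t⟩, toD_le_iff_dom.2 hV⟩

end DualAlgebra

/-- The functor `E ↦ E*`, `(f, lam) ↦ (f, lam)*`. -/
noncomputable def dualAlgebra : ShLPS.{u}ᵒᵖ ⥤ DSL.{u} where
  obj E := { carrier := E.unop.DualAlgebra }
  map φ := { DualAlgebra.mapHom φ.unop with proper := DualAlgebra.mapHom_isProper φ.unop }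
  map_id _ := rfl
  map_comp _ _ := rfl

end ShLPS

/-!
A fully faithful and essentially surjective functor is an equivalence, so the three properties are
checked for `ShLPS.dualAlgebra`.

*Faithful and full.* In a local Priestley space the differences `U \ V` of compact open downsets
form a basis (`CompactOpenDownset.exists_diff_subset`). Therefore the points of `F.base` are
determined by the compact open downsets that contain them, and every germ of `F` is the germ of
an element of `F*` (`ShLPS.exists_dualAlgebra_germ`), which makes the functor faithful. Moreover, by
compactness, every prime filter of `F*` is the filter of all sections defined at some point
(`ShLPS.exists_point_of_prime`). Given a proper homomorphism `h : F* → E*`, a point `x` is sent to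
the point of the prime filter `{a | x ∈ dom (h a)}`; properness says that this filter is nonempty.
On germs, `a ↦ h a` is well defined because agreement of `a` and `b` on `dom c \ dom d` is the
equation `(a ⊓ c) ⊔ d = (b ⊓ c) ⊔ d`, which `h` preserves (`ShLPS.ev_map_eq`); the resulting maps
of stalks assemble to a morphism of sheaves (`ShLPS.homOfMap`).

*Essentially surjective.* For a skew lattice `S`, the maps `S → Bool` that are characteristic
functions of prime filters or of the empty set form a closed subspace of a power of `Bool`. It is
the one-point-compactification of the space `Spectrum S` of prime filters, the empty filter being
the point at infinity, and the compact open downsets of `Spectrum S` are exactly the sets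
`basicOpen a` (`SkewLattice.exists_eq_basicOpen`). The same equation `(a ⊓ c) ⊔ d = (b ⊓ c) ⊔ d`,
with `c` in the prime filter `p` and `d` outside, defines the germs at `p`, and the local sections
built from germs form a sheaf `dualSheaf S`. The homomorphism from `S` to its algebra of sections is
injective, since agreement on pieces of a compact set can be put together by cancellation
(`SkewLattice.Agree.of_split`) and the prime ideal theorem settles inclusions between basic sets;
it is surjective, since a section over a compact open downset can be patched from finitely many
elements by means of `⊓` and `⊔`.
-/

/-! ### Compact open downsets of a local Priestley space -/

namespace CompactOpenDownset

variable {X : LPS.{u}}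

/-- Priestley separation inside `X`: the clopen upset of the one-point-compactification that
separates two points of `X` contains the maximum `∞`, so its complement is a compact subset
of `X`. -/
theorem exists_mem_notMem_of_not_le {x y : X.carrier} (h : ¬ y ≤ x) :
    ∃ U : CompactOpenDownset X, x ∈ U.1 ∧ y ∉ U.1 := by
  obtain ⟨V, hV, hl, hy, hx⟩ :=
    exists_isClopen_lower_of_not_le (mt OnePoint.coe_le_coe_iff.1 h)
  have hi : ∞ ∉ V := fun h => hy (hl (OnePoint.le_infinity _) h)
  exact ⟨⟨⟨((↑) : X.carrier → OnePoint X.carrier) ⁻¹' V,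
    hV.isOpen.preimage OnePoint.continuous_coe⟩,
    ((OnePoint.isClosed_iff_of_notMem hi).1 hV.isClosed).2,
    fun a b h ha => hl (OnePoint.coe_le_coe_iff.2 h) ha⟩, hx, hy⟩

theorem exists_mem (x : X.carrier) : ∃ U : CompactOpenDownset X, x ∈ U.1 := by
  obtain ⟨U, ho, hc, hl, hx⟩ := LocalPriestleySpace.exists_compact_open_downset x
  exact ⟨⟨⟨U, ho⟩, hc, hl⟩, hx⟩

theorem le_of_forall_mem {x y : X.carrier}
    (h : ∀ U : CompactOpenDownset X, y ∈ U.1 → x ∈ U.1) : x ≤ y := by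
  by_contra hxy
  obtain ⟨U, h1, h2⟩ := exists_mem_notMem_of_not_le hxy
  exact h2 (h U h1)

/-- The differences of compact open downsets form a basis of the topology. -/
theorem exists_diff_subset {W : Set X.carrier} (hW : IsOpen W) {y : X.carrier} (hy : y ∈ W) :
    ∃ U V : CompactOpenDownset X, y ∈ U.1 ∧ y ∉ V.1 ∧ ∀ z ∈ U.1, z ∉ V.1 → z ∈ W := by
  obtain ⟨U₀, h₀⟩ := exists_mem y
  have key : ∃ U V : CompactOpenDownset X, y ∈ U.1 ∧ y ∉ V.1 ∧
      ∀ z ∈ U.1, z ∈ (U₀.1 : Set X.carrier) \ W → z ∈ V.1 := by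
    refine (U₀.2.diff hW).induction_on (p := fun T => ∃ U V : CompactOpenDownset X,
      y ∈ U.1 ∧ y ∉ V.1 ∧ ∀ z ∈ U.1, z ∈ T → z ∈ V.1) ?_ ?_ ?_ ?_
    · exact ⟨U₀, ⊥, h₀, fun h => h, fun z _ h => h⟩
    · rintro s t hst ⟨U, V, h1, h2, h3⟩
      exact ⟨U, V, h1, h2, fun z hz hs => h3 z hz (hst hs)⟩
    · rintro s t ⟨U, V, h1, h2, h3⟩ ⟨U', V', h1', h2', h3'⟩
      refine ⟨U ⊓ U', V ⊔ V', ⟨h1, h1'⟩, fun h => h.elim h2 h2', fun z hz hs => ?_⟩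
      exact hs.elim (fun hs => Or.inl (h3 z hz.1 hs)) fun hs => Or.inr (h3' z hz.2 hs)
    · intro z hz
      by_cases hzy : z ≤ y
      · have hyz : ¬ y ≤ z := fun h => hz.2 (le_antisymm hzy h ▸ hy)
        obtain ⟨V, h1, h2⟩ := exists_mem_notMem_of_not_le hyz
        exact ⟨V.1, mem_nhdsWithin_of_mem_nhds (V.1.isOpen.mem_nhds h1), U₀, V, h₀, h2,
          fun _ _ h => h⟩
      · obtain ⟨U, h1, h2⟩ := exists_mem_notMem_of_not_le hzy
        exact ⟨(U.1 : Set X.carrier)ᶜ,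
          mem_nhdsWithin_of_mem_nhds (U.2.isClosed.isOpen_compl.mem_nhds h2),
          U, ⊥, h1, fun h => h, fun z hz h => absurd hz h⟩
  obtain ⟨U, V, h1, h2, h3⟩ := key
  refine ⟨U ⊓ U₀, V, ⟨h1, h₀⟩, h2, fun z hz hzV => ?_⟩
  by_contra hzW
  exact hzV (h3 z hz.1 ⟨hz.2, hzW⟩)

end CompactOpenDownset

/-! ### Sections and germs -/

namespace ShLPS

variable {E F : ShLPS.{u}}

/-- A family of germs that is locally given by sections is given by a section. -/
theorem exists_sec_of_germs {W : Opens E.base.toTop}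
    (g : ∀ x : E.base.toTop, x ∈ W → E.sheaf.presheaf.stalk x)
    (hg : ∀ x ∈ W, ∃ (V : Opens E.base.toTop) (hV : V ≤ W) (s : E.Sec V), x ∈ V ∧
      ∀ y hy, E.germ V y hy s = g y (hV hy)) :
    ∃ s : E.Sec W, ∀ x hx, E.germ W x hx s = g x hx := by
  choose V hV s hx hs using hg
  obtain ⟨r, hr, -⟩ := E.sheaf.existsUnique_gluing' (ι := W) (fun x => V x.1 x.2) W
    (fun x => homOfLE (hV x.1 x.2))
    (fun x h => Opens.mem_iSup.2 ⟨⟨x, h⟩, hx x h⟩) (fun x => s x.1 x.2)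
    (by
      intro x y
      refine E.sec_ext fun z hz => ?_
      refine (E.germ_res (inf_le_left : V x.1 x.2 ⊓ V y.1 y.2 ≤ _) _ z hz).trans ?_
      refine Eq.trans ?_ (E.germ_res (inf_le_right : V x.1 x.2 ⊓ V y.1 y.2 ≤ _) _ z hz).symm
      rw [hs, hs])
  refine ⟨r, fun x h => ?_⟩
  rw [← hs x h x (hx x h), ← E.germ_res (hV x h) r x (hx x h)]
  exact congrArg _ (hr ⟨x, h⟩)

/-- Every germ is the germ of a section over a compact open downset: a section over the difference
of two compact open downsets is extended by an arbitrary one. -/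
theorem exists_dualAlgebra_germ (y : E.base.toTop) (t : E.sheaf.presheaf.stalk y) :
    ∃ (a : E.DualAlgebra) (h : y ∈ a.dom.1), E.germ _ y h a.sec = t := by
  obtain ⟨W, hy, s, rfl⟩ := TopCat.Presheaf.exists_germ_eq E.sheaf.presheaf t
  obtain ⟨U, V, h1, h2, h3⟩ := CompactOpenDownset.exists_diff_subset W.isOpen hy
  obtain ⟨r⟩ := DualAlgebra.exists_sec U.1 U.2
  have hW : U.diff V ≤ W := fun z hz => h3 z hz.1 hz.2
  obtain ⟨q, ⟨hq, -⟩, -⟩ := E.existsUnique_patch (U := U.diff V) (V := (U ⊓ V).1) (W := U.1)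
    (fun z hz => hz.1) (fun z hz => hz.1)
    (fun z hz => by
      by_cases h : z ∈ V.1
      · exact Or.inr ⟨hz, h⟩
      · exact Or.inl ⟨hz, h⟩)
    (fun z hz hz' => hz.2 hz'.2) (E.res hW s)
    (E.res (show (U ⊓ V).1 ≤ U.1 from fun z hz => hz.1) r)
  refine ⟨⟨U, q⟩, h1, ?_⟩
  have hz : y ∈ U.diff V := ⟨h1, h2⟩
  rw [← E.germ_res (show U.diff V ≤ U.1 from fun z hz => hz.1) q y hz, hq, E.germ_res]

/-- Two sections with the same germ at `y` agree on some difference `U \ V` of compact open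
downsets around `y`. -/
theorem exists_diff_of_germ_eq {W W' : Opens F.base.toTop} {y : F.base.toTop} (hy : y ∈ W)
    (hy' : y ∈ W') {s : F.Sec W} {t : F.Sec W'} (h : F.germ W y hy s = F.germ W' y hy' t) :
    ∃ U V : CompactOpenDownset F.base, y ∈ U.1 ∧ y ∉ V.1 ∧
      ∀ z ∈ U.1, z ∉ V.1 → ∃ (h1 : z ∈ W) (h2 : z ∈ W'), F.germ W z h1 s = F.germ W' z h2 t := by
  obtain ⟨N, hyN, i, j, e⟩ := TopCat.Presheaf.germ_eq F.sheaf.presheaf y hy hy' s t h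
  obtain ⟨U, V, h1, h2, h3⟩ := CompactOpenDownset.exists_diff_subset N.isOpen hyN
  refine ⟨U, V, h1, h2, fun z hU hV => ?_⟩
  have hz := h3 z hU hV
  refine ⟨i.le hz, j.le hz, ?_⟩
  rw [← F.germ_res i.le s z hz, ← F.germ_res j.le t z hz]
  exact congrArg _ e

/-- The map of stalks induced by a morphism, on germs of sections over arbitrary open sets. -/
theorem exists_stalkMap_germ (φ : E ⟶ F) (x : E.base.toTop) :
    ∃ k : F.sheaf.presheaf.stalk (LPS.Hom.top (Hom.base φ) x) → E.sheaf.presheaf.stalk x,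
      ∀ (V : Opens F.base.toTop) (hx : LPS.Hom.top (Hom.base φ) x ∈ V) (s : F.Sec V),
        E.germ ((Opens.map (LPS.Hom.top (Hom.base φ))).obj V) x hx ((Hom.nat φ).app (op V) s) =
          k (F.germ V _ hx s) := by
  refine ⟨fun t => E.sheaf.presheaf.stalkPushforward (Type u) (LPS.Hom.top (Hom.base φ)) x
    ((TopCat.Presheaf.stalkFunctor (Type u) _).map (Hom.nat φ) t), fun V h s => ?_⟩
  beta_reduce
  rw [TopCat.Presheaf.stalkFunctor_map_germ_apply]
  exact (ConcreteCategory.congr_hom (TopCat.Presheaf.stalkPushforward_germ (Type u)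
      (LPS.Hom.top (Hom.base φ)) E.sheaf.presheaf V x h) _).symm

/-! ### The functor is faithful -/

theorem base_eq_of_map_eq {φ ψ : E ⟶ F}
    (h : ∀ a : F.DualAlgebra, DualAlgebra.map φ a = DualAlgebra.map ψ a) :
    Hom.base φ = Hom.base ψ := by
  refine LPS.Hom.ext (funext fun x => ?_)
  have key : ∀ U : CompactOpenDownset F.base,
      LPS.Hom.toFun (Hom.base φ) x ∈ U.1 ↔ LPS.Hom.toFun (Hom.base ψ) x ∈ U.1 := fun U => by
    obtain ⟨s⟩ := DualAlgebra.exists_sec U.1 U.2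
    have e := congrArg (fun b : E.DualAlgebra => x ∈ b.dom.1) (h ⟨U, s⟩)
    exact iff_of_eq e
  exact le_antisymm (CompactOpenDownset.le_of_forall_mem fun U => (key U).2)
    (CompactOpenDownset.le_of_forall_mem fun U => (key U).1)

theorem map_injective {φ ψ : E ⟶ F}
    (h : ∀ a : F.DualAlgebra, DualAlgebra.map φ a = DualAlgebra.map ψ a) : φ = ψ := by
  have hb := base_eq_of_map_eq h
  obtain ⟨f, lam⟩ := φ
  obtain ⟨g, mu⟩ := ψ
  obtain rfl : f = g := hb
  congr
  ext V s
  refine E.sec_ext fun x hx => ?_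
  obtain ⟨k, hk⟩ := exists_stalkMap_germ (E := E) (F := F) ⟨f, lam⟩ x
  obtain ⟨l, hl⟩ := exists_stalkMap_germ (E := E) (F := F) ⟨f, mu⟩ x
  obtain ⟨a, ha, e⟩ := exists_dualAlgebra_germ (E := F) _ (F.germ V _ hx s)
  refine (hk V hx s).trans (Eq.trans ?_ (hl V hx s).symm)
  rw [← e, ← hk, ← hl]
  obtain ⟨U, a⟩ := a
  have e' : lam.app (op U.1) a = mu.app (op U.1) a :=
    eq_of_heq (DualAlgebra.mk.inj (h ⟨U, a⟩)).2
  exact congrArg _ e'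

end ShLPS

/-! ### The functor is full -/

namespace ShLPS

variable {E F : ShLPS.{u}}

/-- A prime filter of `F*` is the set of all sections defined at some point. If every point failed,
compactness of one domain would produce `a` in the filter and `b` outside it with
`dom a ⊆ dom b`. -/
theorem exists_point_of_prime (P : F.DualAlgebra → Prop) (h0 : ¬ P 0) (h1 : ∃ a, P a)
    (hinf : ∀ a b, P (a ⊓ b) ↔ P a ∧ P b) (hsup : ∀ a b, P (a ⊔ b) ↔ P a ∨ P b) :
    ∃ y : F.base.toTop, ∀ a : F.DualAlgebra, y ∈ a.dom.1 ↔ P a := by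
  by_contra! hc
  obtain ⟨a₀, ha₀⟩ := h1
  have key : ∃ a b, P a ∧ ¬ P b ∧ ∀ z ∈ (a₀.dom.1 : Set F.base.carrier),
      z ∈ a.dom.1 → z ∈ b.dom.1 := by
    refine a₀.dom.2.induction_on (p := fun T => ∃ a b, P a ∧ ¬ P b ∧ ∀ z ∈ T,
      z ∈ a.dom.1 → z ∈ b.dom.1) ?_ ?_ ?_ ?_
    · exact ⟨a₀, 0, ha₀, h0, fun z h => absurd h (Set.notMem_empty z)⟩
    · rintro s t hst ⟨a, b, h1, h2, h3⟩
      exact ⟨a, b, h1, h2, fun z hz => h3 z (hst hz)⟩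
    · rintro s t ⟨a, b, h1, h2, h3⟩ ⟨a', b', h1', h2', h3'⟩
      refine ⟨a ⊓ a', b ⊔ b', (hinf _ _).2 ⟨h1, h1'⟩, fun h => ((hsup _ _).1 h).elim h2 h2',
        fun z hz hza => ?_⟩
      exact hz.elim (fun hz => Or.inl (h3 z hz hza.1)) fun hz => Or.inr (h3' z hz hza.2)
    · intro y _
      obtain ⟨a, ⟨h1, h2⟩ | ⟨h1, h2⟩⟩ := hc y
      · exact ⟨a.dom.1, mem_nhdsWithin_of_mem_nhds (a.dom.1.isOpen.mem_nhds h1), a₀, a, ha₀, h2,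
          fun z hz _ => hz⟩
      · exact ⟨(a.dom.1 : Set F.base.carrier)ᶜ,
          mem_nhdsWithin_of_mem_nhds (a.dom.2.isClosed.isOpen_compl.mem_nhds h1), a, 0, h2, h0,
          fun z hz hz' => absurd hz' hz⟩
  obtain ⟨a, b, ha, hb, hab⟩ := key
  have hle : a₀ ⊓ a ⊓ b ⊓ (a₀ ⊓ a) = a₀ ⊓ a :=
    SkewLattice.toD_le_iff.1 (DualAlgebra.toD_le_iff_dom.2 fun z hz => hab z hz.1 hz.2)
  have hP : P (a₀ ⊓ a) := (hinf _ _).2 ⟨ha₀, ha⟩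
  rw [← hle, hinf, hinf] at hP
  exact hb hP.1.2

variable (h : SkewLattice.Hom F.DualAlgebra E.DualAlgebra)

theorem exists_point (hp : h.IsProper) (x : E.base.toTop) :
    ∃ y : F.base.toTop, ∀ a : F.DualAlgebra, y ∈ a.dom.1 ↔ x ∈ (h.toFun a).dom.1 := by
  refine exists_point_of_prime (fun a => x ∈ (h.toFun a).dom.1) ?_ ?_ ?_ ?_
  · rw [h.map_zero]
    exact fun h => h
  · obtain ⟨U, hx⟩ := CompactOpenDownset.exists_mem x
    obtain ⟨s⟩ := DualAlgebra.exists_sec U.1 U.2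
    obtain ⟨c, hc⟩ := hp (SkewLattice.toD (⟨U, s⟩ : E.DualAlgebra))
    obtain ⟨a, rfl⟩ := SkewLattice.toD_surjective c
    exact ⟨a, DualAlgebra.toD_le_iff_dom.1 hc hx⟩
  · intro a b
    rw [h.map_inf]
    exact Iff.rfl
  · intro a b
    rw [h.map_sup]
    exact Iff.rfl

variable (hp : h.IsProper)

/-- The map of base spaces dual to a proper homomorphism `F* → E*`: it sends `x` to the point of
the prime filter of all `a` for which `h a` is defined at `x`. -/
noncomputable def pointMap (x : E.base.toTop) : F.base.toTop := (exists_point h hp x).choose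

theorem pointMap_mem_iff {x : E.base.toTop} {a : F.DualAlgebra} :
    pointMap h hp x ∈ a.dom.1 ↔ x ∈ (h.toFun a).dom.1 :=
  (exists_point h hp x).choose_spec a

theorem exists_dualAlgebra_dom (U : CompactOpenDownset F.base) :
    ∃ a : F.DualAlgebra, a.dom = U :=
  let ⟨s⟩ := DualAlgebra.exists_sec U.1 U.2
  ⟨⟨U, s⟩, rfl⟩

theorem continuous_pointMap : Continuous (pointMap h hp) := by
  refine ⟨fun W hW => isOpen_iff_forall_mem_open.2 fun x hx => ?_⟩
  obtain ⟨U, V, h1, h2, h3⟩ := CompactOpenDownset.exists_diff_subset hW hx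
  obtain ⟨a, rfl⟩ := exists_dualAlgebra_dom U
  obtain ⟨b, rfl⟩ := exists_dualAlgebra_dom V
  rw [pointMap_mem_iff] at h1 h2
  refine ⟨_, fun z hz => ?_, ((h.toFun a).dom.diff (h.toFun b).dom).isOpen, ⟨h1, h2⟩⟩
  exact h3 _ ((pointMap_mem_iff h hp).2 hz.1) (mt (pointMap_mem_iff h hp).1 hz.2)

theorem exists_compactOpenDownset_superset {X : LPS.{u}} {K : Set X.carrier} (hK : IsCompact K) :
    ∃ U : CompactOpenDownset X, K ⊆ U.1 := by
  refine hK.induction_on (p := fun s => ∃ U : CompactOpenDownset X, s ⊆ U.1) ?_ ?_ ?_ ?_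
  · exact ⟨⊥, Set.empty_subset _⟩
  · rintro s t h ⟨V, hV⟩
    exact ⟨V, h.trans hV⟩
  · rintro s t ⟨V, hV⟩ ⟨W, hW⟩
    exact ⟨V ⊔ W, Set.union_subset_union hV hW⟩
  · intro x _
    obtain ⟨V, hx⟩ := CompactOpenDownset.exists_mem x
    exact ⟨V.1, mem_nhdsWithin_of_mem_nhds (V.1.isOpen.mem_nhds hx), V, subset_rfl⟩

theorem tendsto_pointMap : Filter.Tendsto (pointMap h hp)
    (Filter.coclosedCompact E.base.carrier) (Filter.coclosedCompact F.base.carrier) := by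
  intro s hs
  rw [Filter.mem_map]
  rw [Filter.mem_coclosedCompact_iff] at hs ⊢
  obtain ⟨U, hU⟩ := exists_compactOpenDownset_superset hs
  obtain ⟨a, rfl⟩ := exists_dualAlgebra_dom U
  refine (h.toFun a).dom.2.of_isClosed_subset isClosed_closure
    (closure_minimal (fun x hx => ?_) (h.toFun a).dom.2.isClosed)
  exact (pointMap_mem_iff h hp).1 (hU (subset_closure hx))

theorem monotone_pointMap : Monotone (pointMap h hp : E.base.carrier → F.base.carrier) := by
  intro x y hxy
  refine CompactOpenDownset.le_of_forall_mem fun U hU => ?_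
  obtain ⟨a, rfl⟩ := exists_dualAlgebra_dom U
  exact (pointMap_mem_iff h hp).2 ((h.toFun a).dom.3 hxy ((pointMap_mem_iff h hp).1 hU))

/-- `pointMap` as a morphism of local Priestley spaces. -/
noncomputable def pointHom : E.base ⟶ F.base where
  toFun := pointMap h hp
  continuous_map := OnePoint.continuous_map (continuous_pointMap h hp) (tendsto_pointMap h hp)
  monotone_map := by
    rintro p q (rfl | ⟨x, y, hxy, rfl, rfl⟩)
    · exact Or.inl rfl
    · exact OnePoint.coe_le_coe_iff.2 (monotone_pointMap h hp hxy)

/-- If `a` and `b` agree on `dom c \ dom d`, then `(a ⊓ c) ⊔ d = (b ⊓ c) ⊔ d`; a homomorphism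
preserves this equation. -/
theorem ev_map_eq {a b c d : F.DualAlgebra}
    (H : ∀ y ∈ c.dom.1, y ∉ d.dom.1 → a.ev y = b.ev y) {x : E.base.toTop}
    (hc : x ∈ (h.toFun c).dom.1) (hd : x ∉ (h.toFun d).dom.1) :
    (h.toFun a).ev x = (h.toFun b).ev x := by
  have e : a ⊓ c ⊔ d = b ⊓ c ⊔ d := DualAlgebra.ev_ext fun y => by
    simp only [DualAlgebra.ev_sup, DualAlgebra.ev_inf]
    by_cases h2 : y ∈ d.dom.1
    · rw [DualAlgebra.ev_of_mem h2, Option.some_or, Option.some_or]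
    · by_cases h1 : y ∈ c.dom.1
      · rw [H y h1 h2]
      · rw [DualAlgebra.ev_of_notMem h1]
        rfl
  have e' := congrArg (fun q => (h.toFun q).ev x) e
  simpa only [h.map_sup, h.map_inf, DualAlgebra.ev_sup, DualAlgebra.ev_inf,
    DualAlgebra.ev_of_notMem hd, DualAlgebra.ev_of_mem hc, Option.none_or, Option.bind_some]
    using e'

theorem germ_map_eq {a b : F.DualAlgebra} {x : E.base.toTop}
    (ha : pointMap h hp x ∈ a.dom.1) (hb : pointMap h hp x ∈ b.dom.1)
    (e : F.germ _ _ ha a.sec = F.germ _ _ hb b.sec) :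
    E.germ _ x ((pointMap_mem_iff h hp).1 ha) (h.toFun a).sec =
      E.germ _ x ((pointMap_mem_iff h hp).1 hb) (h.toFun b).sec := by
  obtain ⟨U, V, h1, h2, h3⟩ := exists_diff_of_germ_eq ha hb e
  obtain ⟨c, rfl⟩ := exists_dualAlgebra_dom U
  obtain ⟨d, rfl⟩ := exists_dualAlgebra_dom V
  have := ev_map_eq h (a := a) (b := b) (c := c) (d := d) (x := x) (fun y hc hd => by
    obtain ⟨h1, h2, e⟩ := h3 y hc hd
    rw [DualAlgebra.ev_of_mem h1, DualAlgebra.ev_of_mem h2]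
    exact congrArg some e) ((pointMap_mem_iff h hp).1 h1) (mt (pointMap_mem_iff h hp).2 h2)
  rw [DualAlgebra.ev_of_mem ((pointMap_mem_iff h hp).1 ha),
    DualAlgebra.ev_of_mem ((pointMap_mem_iff h hp).1 hb)] at this
  exact Option.some.inj this

/-- The map of stalks induced by a proper homomorphism `F* → E*`: it sends the germ of `a` to the
germ of `h a`. -/
noncomputable def stalkMap (x : E.base.toTop)
    (t : F.sheaf.presheaf.stalk (pointMap h hp x)) : E.sheaf.presheaf.stalk x :=
  E.germ _ x ((pointMap_mem_iff h hp).1 (exists_dualAlgebra_germ _ t).choose_spec.choose)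
    (h.toFun (exists_dualAlgebra_germ _ t).choose).sec

theorem stalkMap_germ {a : F.DualAlgebra} {x : E.base.toTop} (ha : pointMap h hp x ∈ a.dom.1) :
    stalkMap h hp x (F.germ _ _ ha a.sec) =
      E.germ _ x ((pointMap_mem_iff h hp).1 ha) (h.toFun a).sec :=
  germ_map_eq h hp _ ha
    (exists_dualAlgebra_germ _ (F.germ _ _ ha a.sec)).choose_spec.choose_spec

theorem exists_sec_stalkMap (V : Opens F.base.toTop) (s : F.Sec V) :
    ∃ t : E.Sec ((Opens.map (LPS.Hom.top (pointHom h hp))).obj V),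
      ∀ (x : E.base.toTop) (hx : pointMap h hp x ∈ V),
        E.germ _ x hx t = stalkMap h hp x (F.germ V _ hx s) := by
  refine exists_sec_of_germs (W := (Opens.map (LPS.Hom.top (pointHom h hp))).obj V)
    (fun x hx => stalkMap h hp x (F.germ V _ hx s)) fun x hx => ?_
  obtain ⟨a, ha, e⟩ := exists_dualAlgebra_germ _ (F.germ V _ hx s)
  obtain ⟨U, U', h1, h2, h3⟩ := exists_diff_of_germ_eq ha hx e
  obtain ⟨c, rfl⟩ := exists_dualAlgebra_dom U
  obtain ⟨d, rfl⟩ := exists_dualAlgebra_dom U'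
  have key : ∀ z ∈ (h.toFun c).dom.diff (h.toFun d).dom,
      ∃ (h1 : pointMap h hp z ∈ a.dom.1) (h2 : pointMap h hp z ∈ V),
        F.germ _ _ h1 a.sec = F.germ V _ h2 s := fun z hz =>
    h3 _ ((pointMap_mem_iff h hp).2 hz.1) (mt (pointMap_mem_iff h hp).1 hz.2)
  have hle : (h.toFun c).dom.diff (h.toFun d).dom ≤ (h.toFun a).dom.1 := fun z hz =>
    (pointMap_mem_iff h hp).1 (key z hz).1
  refine ⟨(h.toFun c).dom.diff (h.toFun d).dom, fun z hz => (key z hz).2.1,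
    E.res hle (h.toFun a).sec,
    ⟨(pointMap_mem_iff h hp).1 h1, mt (pointMap_mem_iff h hp).2 h2⟩, fun z hz => ?_⟩
  obtain ⟨k1, k2, e⟩ := key z hz
  rw [E.germ_res, ← e, stalkMap_germ]

/-- The morphism of sheaves dual to a proper homomorphism `F* → E*`. -/
noncomputable def homOfMap : E ⟶ F where
  base := pointHom h hp
  nat :=
    { app := fun V => TypeCat.ofHom fun s => (exists_sec_stalkMap h hp V.unop s).choose
      naturality := fun V W i => by
        ext s
        refine E.sec_ext fun x hx => ?_
        refine ((exists_sec_stalkMap h hp W.unop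
          (F.res i.unop.le s)).choose_spec x hx).trans ?_
        refine (congrArg (stalkMap h hp x) (F.germ_res i.unop.le s _ hx)).trans ?_
        refine ((exists_sec_stalkMap h hp V.unop s).choose_spec x (i.unop.le hx)).symm.trans ?_
        exact (E.germ_res (show (Opens.map (LPS.Hom.top (pointHom h hp))).obj W.unop ≤
          (Opens.map (LPS.Hom.top (pointHom h hp))).obj V.unop from
          fun z hz => i.unop.le hz) _ x hx).symm }

theorem map_homOfMap (a : F.DualAlgebra) : DualAlgebra.map (homOfMap h hp) a = h.toFun a := by
  refine DualAlgebra.ev_ext fun x => ?_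
  by_cases hx : pointMap h hp x ∈ a.dom.1
  · rw [DualAlgebra.ev_of_mem ((pointMap_mem_iff h hp).1 hx)]
    refine (DualAlgebra.ev_of_mem (a := DualAlgebra.map (homOfMap h hp) a) hx).trans ?_
    refine congrArg some (((exists_sec_stalkMap h hp a.dom.1 a.sec).choose_spec x hx).trans ?_)
    exact stalkMap_germ h hp hx
  · rw [DualAlgebra.ev_of_notMem (mt (pointMap_mem_iff h hp).2 hx)]
    exact DualAlgebra.ev_of_notMem (a := DualAlgebra.map (homOfMap h hp) a) hx

end ShLPS

/-! ### Identities in left-handed strongly distributive skew lattices -/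

namespace SkewLattice

section LeftHanded

variable {S : Type u} [SkewLattice S] [IsLeftHanded S]

theorem below_iff_inf {x y : S} : Below x y ↔ x ⊓ y = x := by
  rw [Below, IsLeftHanded.inf_inf]

theorem Below.sup_eq {x y : S} (h : Below x y) : x ⊔ y = y := by
  rw [← below_iff_inf.1 h, inf_sup_absorb']

/-- `a` and `b` agree on the difference `c \ d`: they have the same restriction to `c` after
overriding by `d`. -/
def Agree (a b c d : S) : Prop := (a ⊓ c) ⊔ d = (b ⊓ c) ⊔ d

theorem Agree.mono_right {a b c d d' : S} (h : Agree a b c d) (hd : Below d d') :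
    Agree a b c d' := by
  have := congrArg (· ⊔ d') h
  simpa only [Agree, sup_assoc, hd.sup_eq] using this

end LeftHanded

section StronglyDistributive

variable {S : Type u} [SkewLattice S] [IsLeftHanded S] [IsStronglyDistributive S]

/-- Two `𝒟`-equivalent elements below `x` in the natural order coincide. Hence `x ⊓ y` depends on
the second argument only through its `𝒟`-class. -/
theorem inf_congr_right (x : S) {y z : S} (h : Below y z) (h' : Below z y) : x ⊓ y = x ⊓ z := by
  set p := x ⊓ y with hp
  set q := x ⊓ z with hq
  have hpq : Below p q :=
    below_inf (inf_below_left _ _) ((inf_below_right _ _).trans h)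
  have hqp : Below q p :=
    below_inf (inf_below_left _ _) ((inf_below_right _ _).trans h')
  have hxp : x ⊔ p = x := sup_inf_absorb x y
  have hxq : x ⊓ q = q := by rw [hq, ← inf_assoc, inf_idem]
  calc p = q ⊔ p := hqp.sup_eq.symm
    _ = (x ⊓ q) ⊔ (p ⊓ q) := by rw [hxq, below_iff_inf.1 hpq]
    _ = (x ⊔ p) ⊓ q := (IsStronglyDistributive.sup_inf _ _ _).symm
    _ = q := by rw [hxp, hxq]

/-- Cancellation. -/
theorem eq_of_inf_eq_of_sup_eq {a b y : S} (h : a ⊓ y = b ⊓ y) (h' : a ⊔ y = b ⊔ y) : a = b := by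
  have below : ∀ {a b : S}, a ⊓ y = b ⊓ y → a ⊔ y = b ⊔ y → Below a b := by
    intro a b h h'
    have e : a = (a ⊓ b) ⊔ (a ⊓ y) := by
      rw [← IsStronglyDistributive.inf_sup, ← h', inf_sup_absorb]
    have := sup_below (inf_below_right a b) (h ▸ inf_below_left b y : Below (a ⊓ y) b)
    rwa [← e] at this
  -- `a` is recovered from its restriction to `y` and the restriction of `a ⊔ y` to `a`
  have recover : ∀ a : S, ((a ⊔ y) ⊓ a) ⊔ (a ⊓ y) = a := by
    intro a
    have hb : Below (y ⊓ a) (a ⊓ y) := below_inf (inf_below_right _ _) (inf_below_left _ _)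
    rw [IsStronglyDistributive.sup_inf, inf_idem, sup_assoc, hb.sup_eq, sup_inf_absorb]
  rw [← recover a, ← recover b, h, h',
    inf_congr_right (b ⊔ y) (below h h') (below h.symm h'.symm)]

namespace Agree

variable {a b e c c' d d' : S}

theorem mono_left (h : Agree a b c d) (hc : Below c' c) : Agree a b c' d := by
  have e : ∀ a : S, (a ⊓ c ⊔ d) ⊓ c' ⊔ d = a ⊓ c' ⊔ d := fun a => by
    rw [IsStronglyDistributive.sup_inf, sup_assoc, (inf_below_left d c').sup_eq, inf_assoc,
      inf_congr_right a (inf_below_right c c') (below_inf hc (Below.refl c'))]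
  rw [Agree, ← e a, ← e b]
  exact congrArg (fun z => z ⊓ c' ⊔ d) h

theorem trans (h : Agree a b c d) (h' : Agree b e c' d') : Agree a e (c ⊓ c') (d ⊔ d') :=
  Eq.trans ((h.mono_left (inf_below_left _ _)).mono_right (below_sup_left _ _))
    ((h'.mono_left (inf_below_right _ _)).mono_right (below_sup_right _ _))

/-- Agreement on the two parts into which `x` splits `c \ d`. -/
theorem of_split (x : S) (h : Agree a b (c ⊓ x) d) (h' : Agree a b c (d ⊔ x)) :
    Agree a b c d := by
  refine eq_of_inf_eq_of_sup_eq (y := x) ?_ ?_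
  · have := congrArg (· ⊓ x) h
    simpa only [IsStronglyDistributive.sup_inf, inf_assoc, inf_idem] using this
  · simpa only [Agree, ← sup_assoc] using h'

end Agree

instance : DistribLattice (DQuot S) where
  le_sup_inf a b c := by
    obtain ⟨x, rfl⟩ := toD_surjective a
    obtain ⟨y, rfl⟩ := toD_surjective b
    obtain ⟨z, rfl⟩ := toD_surjective c
    change toD ((x ⊔ y) ⊓ (x ⊔ z)) ≤ toD (x ⊔ y ⊓ z)
    rw [IsStronglyDistributive.inf_sup, IsStronglyDistributive.sup_inf z x y]
    exact toD_le_iff.2 (sup_below ((inf_below_right _ _).trans (below_sup_left _ _))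
      (sup_below ((inf_below_left _ _).trans (below_sup_left _ _)) (below_sup_right _ _)))

end StronglyDistributive

/-! ### The spectrum of prime filters -/

variable {S : Type u} [SkewLattice S]

/-- `p` is the characteristic function of a prime filter or of the empty set. -/
structure IsPrimeMap (p : S → Bool) : Prop where
  map_zero : p 0 = false
  map_inf (a b : S) : p (a ⊓ b) = (p a && p b)
  map_sup (a b : S) : p (a ⊔ b) = (p a || p b)

theorem IsPrimeMap.of_below {p : S → Bool} (hp : IsPrimeMap p) {a b : S} (h : Below a b)
    (ha : p a = true) : p b = true := by
  rw [← show a ⊓ b ⊓ a = a from h, hp.map_inf, hp.map_inf, Bool.and_eq_true,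
    Bool.and_eq_true] at ha
  exact ha.1.2

variable (S) in
/-- The prime filters of `S`, given by their characteristic functions. -/
def Spectrum : Type u := {p : S → Bool // IsPrimeMap p ∧ ∃ a, p a = true}

namespace Spectrum

instance : CoeFun (Spectrum S) fun _ => S → Bool := ⟨Subtype.val⟩

/-- The topology of pointwise convergence (the patch topology). -/
instance : TopologicalSpace (Spectrum S) := inferInstanceAs (TopologicalSpace (Subtype _))

/-- Reverse inclusion of prime filters. -/
instance : PartialOrder (Spectrum S) where
  le p q := ∀ a, q a = true → p a = true
  le_refl p a h := h
  le_trans p q r h h' a ha := h a (h' a ha)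
  le_antisymm p q h h' := Subtype.ext (funext fun a => Bool.eq_iff_iff.2 ⟨h' a, h a⟩)

theorem prime (p : Spectrum S) : IsPrimeMap p := p.2.1

theorem apply_inf (p : Spectrum S) (a b : S) : p (a ⊓ b) = (p a && p b) := p.prime.map_inf a b

theorem apply_sup (p : Spectrum S) (a b : S) : p (a ⊔ b) = (p a || p b) := p.prime.map_sup a b

theorem apply_zero (p : Spectrum S) : p 0 = false := p.prime.map_zero

theorem continuous_apply (a : S) : Continuous fun p : Spectrum S => p a :=
  (_root_.continuous_apply a).comp continuous_subtype_val

instance : CompactSpace {p : S → Bool // IsPrimeMap p} := by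
  suffices h : IsClosed {p : S → Bool | IsPrimeMap p} from
    isCompact_iff_compactSpace.1 h.isCompact
  have : {p : S → Bool | IsPrimeMap p} = {p | p 0 = false} ∩
      ((⋂ a, ⋂ b, {p | p (a ⊓ b) = (p a && p b)}) ∩
        ⋂ a, ⋂ b, {p | p (a ⊔ b) = (p a || p b)}) := by
    ext p
    simp only [Set.mem_inter_iff, Set.mem_iInter, Set.mem_ofPred_eq]
    exact ⟨fun h => ⟨h.1, h.2, h.3⟩, fun h => ⟨h.1, h.2.1, h.2.2⟩⟩
  have hb (f : Bool → Bool → Bool) (a b : S) : Continuous fun p : S → Bool => f (p a) (p b) :=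
    Continuous.comp (g := fun x : Bool × Bool => f x.1 x.2) continuous_of_discreteTopology
      ((_root_.continuous_apply a).prodMk (_root_.continuous_apply b) :
        Continuous fun p : S → Bool => (p a, p b))
  rw [this]
  refine (isClosed_eq (_root_.continuous_apply _) continuous_const).inter
    ((isClosed_iInter fun a => isClosed_iInter fun b => ?_).inter
      (isClosed_iInter fun a => isClosed_iInter fun b => ?_))
  · exact isClosed_eq (_root_.continuous_apply _) (hb and a b)
  · exact isClosed_eq (_root_.continuous_apply _) (hb or a b)

/-- The inclusion of the spectrum into the space of all prime maps. -/
def incl (p : Spectrum S) : {p : S → Bool // IsPrimeMap p} := ⟨p.1, p.prime⟩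

theorem isEmbedding_incl : Topology.IsEmbedding (incl (S := S)) :=
  Topology.IsEmbedding.of_comp (continuous_subtype_val.subtype_mk _) continuous_subtype_val
    Topology.IsEmbedding.subtypeVal

variable (S) in
/-- The point added in the one-point-compactification: the empty filter. -/
def empty : {p : S → Bool // IsPrimeMap p} :=
  ⟨fun _ => false, ⟨rfl, fun _ _ => rfl, fun _ _ => rfl⟩⟩

theorem range_incl : Set.range (incl (S := S)) = {empty S}ᶜ := by
  ext p
  constructor
  · rintro ⟨q, rfl⟩ h
    obtain ⟨a, ha⟩ := q.2.2
    exact Bool.false_ne_true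
      ((congrFun (congrArg Subtype.val (Set.mem_singleton_iff.1 h)) a).symm.trans ha)
  · intro h
    refine ⟨⟨p.1, p.2, ?_⟩, rfl⟩
    by_contra hc
    push Not at hc
    exact h (Subtype.ext (funext fun a => Bool.eq_false_of_not_eq_true (hc a)))

/-- The one-point-compactification of the spectrum is the space of all prime maps. -/
noncomputable def onePointHomeomorph : OnePoint (Spectrum S) ≃ₜ {p : S → Bool // IsPrimeMap p} :=
  OnePoint.equivOfIsEmbeddingOfRangeEq (empty S) incl isEmbedding_incl range_incl

theorem onePoint_le_iff {x y : OnePoint (Spectrum S)} :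
    x ≤ y ↔ ∀ a, (onePointHomeomorph y).1 a = true → (onePointHomeomorph x).1 a = true := by
  induction y using OnePoint.rec with
  | infty => exact ⟨fun _ a h => absurd h Bool.false_ne_true, fun _ => OnePoint.le_infinity _⟩
  | coe y =>
    induction x using OnePoint.rec with
    | infty =>
      refine ⟨fun h => absurd h (OnePoint.not_infinity_le_coe y), fun h => ?_⟩
      obtain ⟨a, ha⟩ := y.2.2
      exact absurd (h a ha) Bool.false_ne_true
    | coe x => exact OnePoint.coe_le_coe_iff

instance : LocalPriestleySpace (Spectrum S) where
  compactSpace := inferInstance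
  priestley :=
    { priestley := fun {x y} h => by
        rw [onePoint_le_iff] at h
        push Not at h
        obtain ⟨a, hy, hx⟩ := h
        have hc : Continuous fun q : OnePoint (Spectrum S) => (onePointHomeomorph q).1 a :=
          (_root_.continuous_apply a).comp
            (continuous_subtype_val.comp onePointHomeomorph.continuous)
        refine ⟨{q | (onePointHomeomorph q).1 a ≠ true}, ?_, ?_, hx, fun h => h hy⟩
        · exact (isClopen_discrete {b : Bool | b ≠ true}).preimage hc
        · exact fun q r hqr hq hr => hq (onePoint_le_iff.1 hqr a hr) }

end Spectrum

/-- The spectrum as a local Priestley space. -/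
def spec (S : Type u) [SkewLattice S] : LPS.{u} where
  carrier := Spectrum S

/-- The compact open downset of all prime filters that contain `a`. -/
def basicOpen (a : S) : CompactOpenDownset (spec S) where
  toOpens := ⟨{p : Spectrum S | p a = true},
    (isOpen_discrete {true}).preimage (Spectrum.continuous_apply a)⟩
  isCompact := by
    change IsCompact {p : Spectrum S | p a = true}
    rw [Spectrum.isEmbedding_incl.isCompact_iff]
    have : Spectrum.incl '' {p : Spectrum S | p a = true} =
        {q : {p : S → Bool // IsPrimeMap p} | q.1 a = true} := by
      ext q
      exact ⟨fun ⟨p, hp, e⟩ => e ▸ hp, fun h => ⟨⟨q.1, q.2, a, h⟩, h, rfl⟩⟩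
    rw [this]
    exact (isClosed_eq ((continuous_apply a).comp continuous_subtype_val)
      continuous_const).isCompact
  isLowerSet := fun _ _ h ha => h a ha

/-- Every compact open downset of the spectrum is basic. -/
theorem exists_eq_basicOpen (K : CompactOpenDownset (spec S)) : ∃ a : S, K = basicOpen a := by
  have local_basic : ∀ p : Spectrum S, p ∈ K.1 →
      ∃ a, p a = true ∧ ∀ q : Spectrum S, q a = true → q ∈ K.1 := by
    intro p hp
    obtain ⟨a₀, ha₀⟩ := p.2.2
    have key : ∃ a, p a = true ∧ ∀ q : Spectrum S,
        q ∈ ((basicOpen a₀).1 : Set (spec S).carrier) \ K.1 → q a ≠ true := by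
      refine ((basicOpen a₀).2.diff K.1.isOpen).induction_on (p := fun T =>
        ∃ a, p a = true ∧ ∀ q : Spectrum S, q ∈ T → q a ≠ true) ?_ ?_ ?_ ?_
      · exact ⟨a₀, ha₀, fun q h => absurd h (Set.notMem_empty q)⟩
      · rintro s t hst ⟨a, h1, h2⟩
        exact ⟨a, h1, fun q hq => h2 q (hst hq)⟩
      · rintro s t ⟨a, h1, h2⟩ ⟨a', h1', h2'⟩
        refine ⟨a ⊓ a', by rw [p.apply_inf, h1, h1']; rfl, fun q hq h => ?_⟩
        rw [q.apply_inf, Bool.and_eq_true] at h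
        exact hq.elim (fun hq => h2 q hq h.1) fun hq => h2' q hq h.2
      · intro (q : Spectrum S) hq
        have hqp : ¬ q ≤ p := fun h => hq.2 (K.3 h hp)
        change ¬ ∀ a, p a = true → q a = true at hqp
        push Not at hqp
        obtain ⟨a, h1, h2⟩ := hqp
        exact ⟨((basicOpen a).1 : Set (spec S).carrier)ᶜ, mem_nhdsWithin_of_mem_nhds
          ((basicOpen a).2.isClosed.isOpen_compl.mem_nhds h2), a, h1, fun _ h => h⟩
    obtain ⟨a, h1, h2⟩ := key
    refine ⟨a ⊓ a₀, by rw [p.apply_inf, h1, ha₀]; rfl, fun q hq => ?_⟩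
    rw [q.apply_inf, Bool.and_eq_true] at hq
    by_contra hK
    exact h2 q ⟨hq.2, hK⟩ hq.1
  have key : ∃ a : S, (∀ q : Spectrum S, q ∈ (K.1 : Set (spec S).carrier) → q a = true) ∧
      ∀ q : Spectrum S, q a = true → q ∈ K.1 := by
    refine K.2.induction_on (p := fun T => ∃ a : S, (∀ q : Spectrum S, q ∈ T → q a = true) ∧
      ∀ q : Spectrum S, q a = true → q ∈ K.1) ?_ ?_ ?_ ?_
    · exact ⟨0, fun q h => absurd h (Set.notMem_empty q),
        fun q h => absurd (q.apply_zero.symm.trans h) Bool.false_ne_true⟩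
    · rintro s t hst ⟨a, h1, h2⟩
      exact ⟨a, fun q hq => h1 q (hst hq), h2⟩
    · rintro s t ⟨a, h1, h2⟩ ⟨a', h1', h2'⟩
      refine ⟨a ⊔ a', fun (q : Spectrum S) hq => ?_, fun q hq => ?_⟩
      · rw [q.apply_sup, Bool.or_eq_true]
        exact hq.imp (h1 q) (h1' q)
      · rw [q.apply_sup, Bool.or_eq_true] at hq
        exact hq.elim (h2 q) (h2' q)
    · intro p hp
      obtain ⟨a, h1, h2⟩ := local_basic p hp
      exact ⟨(basicOpen a).1, mem_nhdsWithin_of_mem_nhds ((basicOpen a).1.isOpen.mem_nhds h1),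
        a, fun _ h => h, h2⟩
  obtain ⟨a, h1, h2⟩ := key
  exact ⟨a, CompactOpenDownset.ext (Opens.ext (Set.ext fun q => ⟨h1 q, h2 q⟩))⟩

variable [IsStronglyDistributive S]

/-- Prime filters separate `𝒟`-classes. A top element is added to `S/𝒟` in order to apply the prime
ideal theorem for bounded distributive lattices. -/
theorem exists_isPrimeMap_of_not_below {a b : S} (h : ¬ Below a b) :
    ∃ p : S → Bool, IsPrimeMap p ∧ p a = true ∧ p b = false := by
  classical
  let _ : OrderBot (DQuot S) :=
    { bot := toD 0
      bot_le := fun c => by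
        obtain ⟨x, rfl⟩ := toD_surjective c
        rw [toD_le_iff, zero_inf, zero_inf] }
  let i : S → WithTop (DQuot S) := fun x => (toD x : WithTop (DQuot S))
  have hd : Disjoint (Order.PFilter.principal (i a) : Set (WithTop (DQuot S)))
      (Order.Ideal.principal (i b) : Set (WithTop (DQuot S))) := by
    refine Set.disjoint_left.2 fun x h1 h2 => h ?_
    have h3 : i a ≤ i b := le_trans h1 h2
    exact toD_le_iff.1 (WithTop.coe_le_coe.1 h3)
  obtain ⟨J, hJ, hbJ, haJ⟩ := DistribLattice.prime_ideal_of_disjoint_filter_ideal hd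
  have hb : i b ∈ J := hbJ (Order.Ideal.mem_principal.2 le_rfl)
  have ha : i a ∉ J := fun h => Set.disjoint_left.1 haJ (Order.PFilter.mem_principal.2 le_rfl) h
  refine ⟨fun x => decide (i x ∉ J), ⟨?_, fun x y => ?_, fun x y => ?_⟩, by simpa using ha,
    by simpa using hb⟩
  · have : i 0 ∈ J := J.bot_mem
    simpa using this
  · have : i (x ⊓ y) ∈ J ↔ i x ∈ J ∨ i y ∈ J := by
      refine ⟨hJ.mem_or_mem (x := i x) (y := i y), ?_⟩
      rintro (h | h)
      · exact J.lower (WithTop.coe_le_coe.2 (inf_le_left : toD x ⊓ toD y ≤ _)) h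
      · exact J.lower (WithTop.coe_le_coe.2 (inf_le_right : toD x ⊓ toD y ≤ _)) h
    simp [this]
  · have : i (x ⊔ y) ∈ J ↔ i x ∈ J ∧ i y ∈ J := Order.Ideal.sup_mem_iff (x := i x) (y := i y)
    rw [Bool.eq_iff_iff]
    simp [this, imp_iff_not_or]

theorem Spectrum.below_iff {a b : S} : Below a b ↔ ∀ p : Spectrum S, p a = true → p b = true := by
  refine ⟨fun h p => p.prime.of_below h, fun h => ?_⟩
  by_contra hab
  obtain ⟨p, hp, ha, hb⟩ := exists_isPrimeMap_of_not_below hab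
  exact Bool.false_ne_true (hb.symm.trans (h ⟨p, hp, a, ha⟩ ha))

end SkewLattice

/-! ### The sheaf of a skew lattice -/

namespace SkewLattice

variable {S : Type u} [SkewLattice S]

theorem sup_zero (x : S) : x ⊔ 0 = x := by
  have := sup_inf_absorb x 0
  rwa [inf_zero] at this

variable [IsLeftHanded S] [IsStronglyDistributive S]

/-- Two elements of the prime filter `p` have the same germ at `p` if they agree on some basic
neighbourhood of `p`. -/
def germSetoid (p : Spectrum S) : Setoid {a : S // p a = true} where
  r a b := ∃ c d : S, p c = true ∧ p d = false ∧ Agree a.1 b.1 c d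
  iseqv :=
    { refl := fun a => ⟨a.1, 0, a.2, p.apply_zero, rfl⟩
      symm := fun ⟨c, d, hc, hd, h⟩ => ⟨c, d, hc, hd, Eq.symm h⟩
      trans := fun ⟨c, d, hc, hd, h⟩ ⟨c', d', hc', hd', h'⟩ =>
        ⟨c ⊓ c', d ⊔ d', by rw [p.apply_inf, hc, hc']; rfl, by rw [p.apply_sup, hd, hd']; rfl,
          h.trans h'⟩ }

/-- The set of germs at the prime filter `p`. -/
def Germ (p : Spectrum S) : Type u := Quotient (germSetoid p)

/-- The germ of `a` at a prime filter that contains it. -/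
def Germ.mk {p : Spectrum S} (a : S) (ha : p a = true) : Germ p :=
  Quotient.mk (germSetoid p) ⟨a, ha⟩

theorem Germ.mk_eq_mk {p : Spectrum S} {a b : S} {ha : p a = true} {hb : p b = true} :
    Germ.mk a ha = Germ.mk b hb ↔ ∃ c d : S, p c = true ∧ p d = false ∧ Agree a b c d :=
  Quotient.eq (r := germSetoid p)

/-- The value of `a`, as a partial section of the space of germs, at `p`. -/
def partialGerm (a : S) (p : Spectrum S) : Option (Germ p) :=
  if h : p a = true then some (Germ.mk a h) else none

theorem partialGerm_of_mem {a : S} {p : Spectrum S} (h : p a = true) :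
    partialGerm a p = some (Germ.mk a h) := dif_pos h

theorem partialGerm_of_notMem {a : S} {p : Spectrum S} (h : ¬ p a = true) :
    partialGerm a p = none := dif_neg h

theorem partialGerm_zero (p : Spectrum S) : partialGerm (0 : S) p = none :=
  partialGerm_of_notMem (by rw [p.apply_zero]; exact Bool.false_ne_true)

theorem partialGerm_inf (a b : S) (p : Spectrum S) :
    partialGerm (a ⊓ b) p = (partialGerm b p).bind fun _ => partialGerm a p := by
  by_cases hb : p b = true
  · by_cases ha : p a = true
    · have h : p (a ⊓ b) = true := by rw [p.apply_inf, ha, hb]; rfl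
      rw [partialGerm_of_mem h, partialGerm_of_mem hb, partialGerm_of_mem ha]
      refine congrArg some (Germ.mk_eq_mk.2 ⟨b, 0, hb, p.apply_zero, ?_⟩)
      rw [Agree, inf_assoc, inf_idem]
    · have h : ¬ p (a ⊓ b) = true := by
        rw [p.apply_inf, Bool.and_eq_true]
        exact fun h => ha h.1
      rw [partialGerm_of_notMem h, partialGerm_of_mem hb, partialGerm_of_notMem ha]
      rfl
  · have h : ¬ p (a ⊓ b) = true := by
      rw [p.apply_inf, Bool.and_eq_true]
      exact fun h => hb h.2
    rw [partialGerm_of_notMem h, partialGerm_of_notMem hb]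
    rfl

theorem partialGerm_sup (a b : S) (p : Spectrum S) :
    partialGerm (a ⊔ b) p = (partialGerm b p).or (partialGerm a p) := by
  by_cases hb : p b = true
  · have h : p (a ⊔ b) = true := by rw [p.apply_sup, hb, Bool.or_true]
    rw [partialGerm_of_mem h, partialGerm_of_mem hb, Option.some_or]
    refine congrArg some (Germ.mk_eq_mk.2 ⟨b, 0, hb, p.apply_zero, ?_⟩)
    rw [Agree, sup_inf_absorb', inf_idem]
  · rw [partialGerm_of_notMem hb, Option.none_or]
    by_cases ha : p a = true
    · have h : p (a ⊔ b) = true := by rw [p.apply_sup, ha, Bool.true_or]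
      rw [partialGerm_of_mem h, partialGerm_of_mem ha]
      refine congrArg some (Germ.mk_eq_mk.2 ⟨a, b, ha, Bool.eq_false_of_not_eq_true hb, ?_⟩)
      rw [Agree, IsStronglyDistributive.sup_inf, sup_assoc, (inf_below_left b a).sup_eq]
    · have h : ¬ p (a ⊔ b) = true := by
        rw [p.apply_sup, Bool.or_eq_true]
        exact fun h => h.elim ha hb
      rw [partialGerm_of_notMem h, partialGerm_of_notMem ha]

/-- Agreement near every prime filter that contains `a` is agreement on all of `a`. The property of
sets `T` that compactness propagates to `basicOpen a` reads: `a` and `b` agree on `c \ d` as soon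
as they agree on every difference contained in `c \ d` and disjoint from `T`. -/
theorem agree_of_forall_germ {a b : S}
    (h : ∀ p : Spectrum S, p a = true → ∃ c d : S, p c = true ∧ p d = false ∧ Agree a b c d) :
    Agree a b a 0 := by
  have key : ∀ c d : S, (∀ c' d' : S, (∀ q : Spectrum S, q c' = true → q d' ≠ true →
      (q c = true ∧ q d ≠ true) ∧ q ∉ ((basicOpen a).1 : Set (spec S).carrier)) →
      Agree a b c' d') → Agree a b c d := by
    refine (basicOpen a).2.induction_on (p := fun T => ∀ c d : S, (∀ c' d' : S,
      (∀ q : Spectrum S, q c' = true → q d' ≠ true → (q c = true ∧ q d ≠ true) ∧ q ∉ T) →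
      Agree a b c' d') → Agree a b c d) ?_ ?_ ?_ ?_
    · exact fun c d H => H c d fun q hc hd => ⟨⟨hc, hd⟩, Set.notMem_empty q⟩
    · intro s t hst ht c d H
      exact ht c d fun c' d' H' => H c' d' fun q hc hd =>
        ⟨(H' q hc hd).1, fun hq => (H' q hc hd).2 (hst hq)⟩
    · intro s t hs ht c d H
      refine hs c d fun c' d' H' => ht c' d' fun c'' d'' H'' => H c'' d'' fun q hc hd => ?_
      obtain ⟨h1, h2⟩ := H'' q hc hd
      obtain ⟨h3, h4⟩ := H' q h1.1 h1.2
      exact ⟨h3, fun hq => hq.elim h4 h2⟩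
    · intro (p : Spectrum S) hp
      obtain ⟨u, v, hu, hv, huv⟩ := h p hp
      refine ⟨(basicOpen u).diff (basicOpen v), mem_nhdsWithin_of_mem_nhds
        (((basicOpen u).diff (basicOpen v)).isOpen.mem_nhds
          ⟨hu, show ¬ p v = true by rw [hv]; exact Bool.false_ne_true⟩), fun c d H => ?_⟩
      -- `c \ d` is the union of `(c ⊓ u ⊓ v) \ d`, `(c ⊓ u) \ (d ⊔ v)` and `c \ (d ⊔ u)`
      refine Agree.of_split u (Agree.of_split v (H _ _ fun q hc hd => ?_)
        ((huv.mono_left (inf_below_right c u)).mono_right (below_sup_right d v)))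
        (H _ _ fun q hc hd => ?_)
      · rw [q.apply_inf, q.apply_inf, Bool.and_eq_true, Bool.and_eq_true] at hc
        exact ⟨⟨hc.1.1, hd⟩, fun hq => hq.2 hc.2⟩
      · rw [q.apply_sup, ne_eq, Bool.or_eq_true] at hd
        exact ⟨⟨hc, fun h => hd (Or.inl h)⟩, fun hq => hd (Or.inr hq.1)⟩
  refine key a 0 fun c' d' H => ?_
  have hb : Below c' d' := Spectrum.below_iff.2 fun q hc => by
    by_contra hd
    exact (H q hc hd).2 (H q hc hd).1.1
  rw [Agree, ((inf_below_right a c').trans hb).sup_eq, ((inf_below_right b c').trans hb).sup_eq]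

theorem eq_of_partialGerm_eq {a b : S} (h : ∀ p : Spectrum S, partialGerm a p = partialGerm b p) :
    a = b := by
  have below : ∀ {a b : S}, (∀ p : Spectrum S, partialGerm a p = partialGerm b p) →
      Below a b := fun {a b} h => Spectrum.below_iff.2 fun p ha => by
    by_contra hb
    have := h p
    rw [partialGerm_of_mem ha, partialGerm_of_notMem hb] at this
    exact Option.some_ne_none _ this
  have := agree_of_forall_germ (a := a) (b := b) fun p ha => by
    have hb : p b = true := p.prime.of_below (below h) ha
    have e := h p
    rw [partialGerm_of_mem ha, partialGerm_of_mem hb] at e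
    exact Germ.mk_eq_mk.1 (Option.some.inj e)
  rw [Agree, sup_zero, sup_zero, inf_idem,
    below_iff_inf.1 (below fun p => (h p).symm)] at this
  exact this

variable (S) in
/-- The sections of the sheaf of germs are locally the germs of a single element. -/
def germPredicate : TopCat.PrelocalPredicate (X := (spec S).toTop)
    (fun p => Germ (show Spectrum S from p)) where
  pred {U} f := ∃ a : S, ∀ x : U, ∃ h : (show Spectrum S from x.1) a = true, f x = Germ.mk a h
  res i _ := fun ⟨a, ha⟩ => ⟨a, fun x => ha ⟨x.1, i.le x.2⟩⟩

variable (S) in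
/-- The sheaf of germs of a skew lattice on its spectrum. -/
def germSheaf : TopCat.Sheaf (Type u) (spec S).toTop :=
  TopCat.subsheafToTypes (germPredicate S).sheafify

/-- The section over `basicOpen a` given by the germs of `a`. -/
def basicSec (a : S) : (germSheaf S).presheaf.obj (op (basicOpen a).1) :=
  ⟨fun x => Germ.mk a x.2,
    TopCat.PrelocalPredicate.sheafifyOf (P := germPredicate S) ⟨a, fun x => ⟨x.2, rfl⟩⟩⟩

variable (S) in
/-- The object of `ShLPS` dual to a skew lattice. -/
def dualSheaf : ShLPS.{u} where
  base := spec S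
  sheaf := germSheaf S
  nonempty_stalk p := by
    obtain ⟨a, ha⟩ := (show Spectrum S from p).2.2
    exact ⟨(germSheaf S).presheaf.germ (basicOpen a).1 p ha (basicSec a)⟩

/-- The local section of the dual sheaf given by the germs of `a`. -/
def toDualAlgebra (a : S) : (dualSheaf S).DualAlgebra := ⟨basicOpen a, basicSec a⟩

/-- The value of a local section at `p`, in the set of germs instead of the stalk. -/
noncomputable def value (b : (dualSheaf S).DualAlgebra) (p : Spectrum S) : Option (Germ p) :=
  (b.ev p).map (TopCat.stalkToFiber (germPredicate S).sheafify p)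

theorem value_of_mem {b : (dualSheaf S).DualAlgebra} {p : Spectrum S} (h : p ∈ b.dom.1) :
    value b p = some (b.sec.1 ⟨p, h⟩) := by
  rw [value, ShLPS.DualAlgebra.ev_of_mem h]
  exact congrArg some (TopCat.stalkToFiber_germ (germPredicate S).sheafify b.dom.1 p h b.sec)

theorem value_of_notMem {b : (dualSheaf S).DualAlgebra} {p : Spectrum S} (h : p ∉ b.dom.1) :
    value b p = none := by
  rw [value, ShLPS.DualAlgebra.ev_of_notMem h]
  rfl

theorem isSome_value (b : (dualSheaf S).DualAlgebra) (p : Spectrum S) :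
    (value b p).isSome = true ↔ p ∈ b.dom.1 := by
  by_cases h : p ∈ b.dom.1
  · rw [value_of_mem h]
    exact iff_of_true rfl h
  · rw [value_of_notMem h]
    exact iff_of_false Bool.false_ne_true h

theorem value_inf (a b : (dualSheaf S).DualAlgebra) (p : Spectrum S) :
    value (a ⊓ b) p = (value b p).bind fun _ => value a p := by
  refine (congrArg (Option.map _) (ShLPS.DualAlgebra.ev_inf a b p)).trans ?_
  rw [value, value]
  cases b.ev p <;> rfl

theorem value_sup (a b : (dualSheaf S).DualAlgebra) (p : Spectrum S) :
    value (a ⊔ b) p = (value b p).or (value a p) := by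
  refine (congrArg (Option.map _) (ShLPS.DualAlgebra.ev_sup a b p)).trans ?_
  rw [value, value]
  cases b.ev p <;> rfl

theorem value_ext {a b : (dualSheaf S).DualAlgebra} (h : ∀ p, value a p = value b p) : a = b := by
  obtain ⟨U, s⟩ := a
  obtain ⟨V, t⟩ := b
  obtain rfl : U = V := CompactOpenDownset.ext (Opens.ext (Set.ext fun x =>
    (isSome_value ⟨U, s⟩ x).symm.trans
      ((iff_of_eq (congrArg (fun o => o.isSome = true) (h x))).trans (isSome_value ⟨V, t⟩ x))))
  congr
  refine Subtype.ext (funext fun x => ?_)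
  have := h x.1
  rw [value_of_mem (b := ⟨U, s⟩) x.2, value_of_mem (b := ⟨U, t⟩) x.2] at this
  exact Option.some.inj this

theorem value_toDualAlgebra (a : S) (p : Spectrum S) :
    value (toDualAlgebra a) p = partialGerm a p := by
  by_cases h : p a = true
  · rw [partialGerm_of_mem h]
    exact value_of_mem (b := toDualAlgebra a) h
  · rw [partialGerm_of_notMem h]
    exact value_of_notMem (b := toDualAlgebra a) h

variable (S) in
/-- The homomorphism from a skew lattice to the local sections of its dual sheaf. -/
def toDualAlgebraHom : Hom S (dualSheaf S).DualAlgebra where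
  toFun := toDualAlgebra
  map_inf a b := value_ext fun p => by
    simp only [value_inf, value_toDualAlgebra, partialGerm_inf]
  map_sup a b := value_ext fun p => by
    simp only [value_sup, value_toDualAlgebra, partialGerm_sup]
  map_zero := value_ext fun p => by
    rw [value_toDualAlgebra, partialGerm_zero]
    exact (value_of_notMem (b := 0) fun h => h).symm

theorem toDualAlgebra_injective : Function.Injective (toDualAlgebra (S := S)) := fun a b h =>
  eq_of_partialGerm_eq fun p => by rw [← value_toDualAlgebra, h, value_toDualAlgebra]

/-- Every local section over a compact open downset is given by a single element. By compactness,
an element with the given domain is corrected finitely many times: near a point, its values on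
`c \ d` are replaced by those of an `a` that represents the section there. -/
theorem toDualAlgebra_surjective : Function.Surjective (toDualAlgebra (S := S)) := by
  intro b
  obtain ⟨u, hu⟩ := exists_eq_basicOpen b.dom
  have hdom : ∀ q : Spectrum S, q ∈ b.dom.1 ↔ q u = true := fun q => by rw [hu]; rfl
  have key : ∀ e : S, (∀ q : Spectrum S, q e = true ↔ q u = true) →
      ∃ e' : S, (∀ q : Spectrum S, q e' = true ↔ q u = true) ∧
        ∀ q : Spectrum S,
          (q ∈ (b.dom.1 : Set (dualSheaf S).base.carrier) → partialGerm e' q = value b q) ∧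
          (partialGerm e q = value b q → partialGerm e' q = value b q) := by
    refine b.dom.2.induction_on (p := fun T => ∀ e : S,
      (∀ q : Spectrum S, q e = true ↔ q u = true) →
      ∃ e' : S, (∀ q : Spectrum S, q e' = true ↔ q u = true) ∧
        ∀ q : Spectrum S, (q ∈ T → partialGerm e' q = value b q) ∧
          (partialGerm e q = value b q → partialGerm e' q = value b q)) ?_ ?_ ?_ ?_
    · exact fun e he => ⟨e, he, fun q => ⟨fun h => absurd h (Set.notMem_empty q), id⟩⟩
    · intro s t hst ht e he
      obtain ⟨e', he', h⟩ := ht e he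
      exact ⟨e', he', fun q => ⟨fun hq => (h q).1 (hst hq), (h q).2⟩⟩
    · intro s t hs ht e he
      obtain ⟨e', he', h⟩ := hs e he
      obtain ⟨e'', he'', h'⟩ := ht e' he'
      exact ⟨e'', he'', fun q => ⟨fun hq => hq.elim (fun hq => (h' q).2 ((h q).1 hq)) (h' q).1,
        fun hq => (h' q).2 ((h q).2 hq)⟩⟩
    · intro (p : Spectrum S) hp
      obtain ⟨V, hpV, i, a, ha⟩ := b.sec.2 ⟨p, hp⟩
      obtain ⟨U, U', h1, h2, h3⟩ := CompactOpenDownset.exists_diff_subset V.isOpen hpV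
      obtain ⟨c, rfl⟩ := exists_eq_basicOpen U
      obtain ⟨d, rfl⟩ := exists_eq_basicOpen U'
      have hV : ∀ q : Spectrum S, q c = true → ¬ q d = true →
          q a = true ∧ q u = true ∧ partialGerm a q = value b q := fun q hc hd => by
        have hq : q ∈ V := h3 q hc hd
        obtain ⟨hqa, e⟩ := ha ⟨q, hq⟩
        refine ⟨hqa, (hdom q).1 (i.le hq), ?_⟩
        rw [partialGerm_of_mem hqa, value_of_mem (i.le hq)]
        exact congrArg some e.symm
      refine ⟨{q : Spectrum S | q ∈ (basicOpen c).diff (basicOpen d)}, mem_nhdsWithin_of_mem_nhds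
        (((basicOpen c).diff (basicOpen d)).isOpen.mem_nhds ⟨h1, h2⟩), fun e he => ?_⟩
      refine ⟨e ⊔ a ⊓ (c ⊓ u) ⊔ e ⊓ d, fun q => ?_, fun q => ?_⟩
      · simp only [q.apply_sup, q.apply_inf, Bool.or_eq_true, Bool.and_eq_true, he]
        tauto
      · have good : q c = true → ¬ q d = true →
            partialGerm (e ⊔ a ⊓ (c ⊓ u) ⊔ e ⊓ d) q = value b q := fun hc hd => by
          obtain ⟨hqa, hqu, hq⟩ := hV q hc hd
          rw [← hq]
          simp only [partialGerm_sup, partialGerm_inf, partialGerm_of_notMem hd,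
            partialGerm_of_mem hc, partialGerm_of_mem hqu, partialGerm_of_mem hqa,
            Option.bind_none, Option.bind_some, Option.none_or, Option.some_or]
        refine ⟨fun hq => good hq.1 hq.2, fun hq => ?_⟩
        by_cases hd : q d = true
        · rw [← hq]
          simp only [partialGerm_sup, partialGerm_inf, partialGerm_of_mem hd, Option.bind_some]
          by_cases hqe : q e = true
          · rw [partialGerm_of_mem hqe, Option.some_or]
          · have hqu : ¬ q u = true := mt (he q).2 hqe
            rw [partialGerm_of_notMem hqe, partialGerm_of_notMem hqu]
            rfl
        · by_cases hc : q c = true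
          · exact good hc hd
          · rw [← hq]
            simp only [partialGerm_sup, partialGerm_inf, partialGerm_of_notMem hd,
              partialGerm_of_notMem hc, Option.bind_none, Option.none_or]
            cases partialGerm u q <;> rfl
  obtain ⟨e, he, h⟩ := key u fun q => Iff.rfl
  refine ⟨e, value_ext fun q => ?_⟩
  rw [value_toDualAlgebra]
  by_cases hq : q ∈ b.dom.1
  · exact (h q).1 hq
  · rw [value_of_notMem hq, partialGerm_of_notMem (mt (he q).1 (mt (hdom q).2 hq))]

end SkewLattice

/-! ### The equivalence -/

namespace DSL

/-- A bijective homomorphism is proper, and so is its inverse. -/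
theorem nonempty_iso_of_bijective {S T : DSL.{u}} (h : SkewLattice.Hom S.carrier T.carrier)
    (hb : Function.Bijective h.toFun) : Nonempty (S ≅ T) := by
  obtain ⟨k, hk, hk'⟩ := Function.bijective_iff_has_inverse.1 hb
  exact ⟨{
    hom :=
      { h with
        proper := fun y => by
          obtain ⟨y, rfl⟩ := SkewLattice.toD_surjective y
          refine ⟨SkewLattice.toD (k y), ?_⟩
          rw [SkewLattice.Hom.bar_toD, hk'] }
    inv :=
      { toFun := k
        map_inf := fun x y => hb.1 (by rw [h.map_inf, hk', hk', hk'])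
        map_sup := fun x y => hb.1 (by rw [h.map_sup, hk', hk', hk'])
        map_zero := hb.1 (by rw [h.map_zero, hk'])
        proper := fun x => by
          obtain ⟨x, rfl⟩ := SkewLattice.toD_surjective x
          refine ⟨SkewLattice.toD (h.toFun x), ?_⟩
          exact le_of_eq (congrArg SkewLattice.toD (hk x).symm) }
    hom_inv_id := Hom.ext (funext hk)
    inv_hom_id := Hom.ext (funext hk') }⟩

end DSL

namespace ShLPS

instance : dualAlgebra.{u}.Faithful where
  map_injective h := by
    refine Quiver.Hom.unop_inj (map_injective fun a => ?_)
    exact congrFun (congrArg (fun k : DSL.Hom _ _ => k.toFun) h) a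

instance : dualAlgebra.{u}.Full where
  map_surjective h :=
    ⟨(homOfMap (DSL.Hom.toHom h) (DSL.Hom.proper h)).op, DSL.Hom.ext (funext fun a =>
      map_homOfMap (DSL.Hom.toHom h) (DSL.Hom.proper h) a)⟩

instance : dualAlgebra.{u}.EssSurj where
  mem_essImage S := by
    obtain ⟨e⟩ := DSL.nonempty_iso_of_bijective (S := S)
      (T := dualAlgebra.obj (op (SkewLattice.dualSheaf S.carrier)))
      (SkewLattice.toDualAlgebraHom S.carrier)
      ⟨SkewLattice.toDualAlgebra_injective, SkewLattice.toDualAlgebra_surjective⟩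
    exact ⟨_, ⟨e.symm⟩⟩

instance : dualAlgebra.{u}.IsEquivalence where

end ShLPS

/-- The contravariant functor `E ↦ E*` is (the functor part of) an equivalence between the opposite
of the category of sheaves over local Priestley spaces and the category of left-handed strongly
distributive skew lattices with zero. -/
theorem theorem3p1 : ∃ e : ShLPS.{u}ᵒᵖ ≌ DSL.{u}, e.functor = ShLPS.dualAlgebra.{u} :=
  ⟨ShLPS.dualAlgebra.asEquivalence, rfl⟩
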